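/- **Setting.** For $l=1,2$ let $\mathbb R^{m_l}$ carry a norm $\|\cdot\|$ with dual norm $\|y\|_*=\sup_{\|x\|\le1}\langle y,x\rangle$, let $X_l\subset\mathbb R^{m_l}$ be nonempty, compact and convex, and let $O_l\supseteq X_l$ be open. Network $\Sigma_l$ has agents $\mathcal V_l=\{1,\dots,n_l\}$, $n_l\ge1$. Let $(\Omega,\mathcal F,\mathbb P)$ be a probability space, $\xi:\Omega\to\mathbb R^d$ a random vector, and let agent $i\in\mathcal V_l$ have the cost $f_{l,i}(x_1,x_2)=\mathbb E[\Psi_{l,i}(x_1,x_2;\xi)]$, defined (with $\Psi_{l,i}(x_1,x_2;\xi)$ integrable) for $(x_1,x_2)\in O_1\times O_2$. On $X_1\times X_2$ each $f_{1,i}$ is convex in $x_1$ and concave in $x_2$, each $f_{2,j}$ is concave in $x_1$ and convex in $x_2$, and $$U:=\frac1{n_1}\sum_{i=1}^{n_1}f_{1,i}=-\frac1{n_2}\sum_{j=1}^{n_2}f_{2,j}.$$ The symbol $\partial_l$ denotes the subdifferential with respect to $x_l\in O_l$. *Communication.* Let $0<\eta<1$ and $B_l\ge 1$ be an integer. $\mathcal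 G_l(t)=(\mathcal V_l,\mathcal E_l(t))$, $t\ge0$, are digraphs with $(i,i)\in\mathcal E_l(t)$ for all $i$, such that $(\mathcal V_l,\bigcup_{t=k}^{k+B_l-1}\mathcal E_l(t))$ is strongly connected for every $k\ge0$. The matrices $W_l(t)=[w_{l,ij}(t)]$ have all row and column sums $1$, with $w_{l,ij}(t)\ge\eta$ if $(j,i)\in\mathcal E_l(t)$ and $w_{l,ij}(t)=0$ otherwise. Between the networks there are weights $w_{12,ij}(t)\ge0$ ($i\in\mathcal V_l$, $j\in\mathcal V_{3-l}$), positive only if $(j,i)$ is an edge of a digraph $\mathcal G_{12}(t)$ on $\mathcal V_1\cup\mathcal V_2$, with $\sum_{j}w_{12,ij}(t)=1$ for every $i$. Put $\Gamma_l=(1-\eta/(4n_l^2))^{-2}$ and $\theta_l=(1-\eta/(4n_l^2))^{1/B_l}$. *Algorithm (D-SMD).* Let $\psi_l$ be differentiable and $1$-strongly convex on $X_l$, $D_{\psi_l}(x,p)=\psi_l(x)-\psi_l(p)-\langle\nabla\psi_l(p),x-p\rangle$, and $P^l_x(y)=\arg\min_{x'\in X_l}\{\langle y,x-x'\rangle+D_{\psi_l}(x',x)\}$.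 Let $\{\alpha(t)\}_{t\ge0}$ be nonnegative and non-increasing. From deterministic $x_{l,i}(0)\in X_l$, for $t\ge0$, $l=1,2$ and $i\in\mathcal V_l$, $$v_{l,i}(t)=\sum_{j=1}^{n_l}w_{l,ij}(t)x_{l,j}(t),\qquad u_{3-l,i}(t)=\sum_{j=1}^{n_{3-l}}w_{12,ij}(t)x_{3-l,j}(t),\qquad x_{l,i}(t+1)=P^l_{v_{l,i}(t)}(-\alpha(t)\hat g_{l,i}(t)),$$ where $\hat g_{l,i}(t)$ is a sampled subgradient in $\partial_l\Psi_{l,i}(\cdot,\cdot;\xi_{l,i}(t))$ at the point with $l$-th coordinate $v_{l,i}(t)$ and other coordinate $u_{3-l,i}(t)$, and the $\xi_{l,i}(t)$ are i.i.d. copies of $\xi$. Let $\mathcal F_t=\sigma\{x_{l,i}(0),\xi_{l,i}(s): l=1,2,\ i\in\mathcal V_l,\ 0\le s\le t-1\}$; $\hat g_{l,i}(t)$ is $\mathcal F_{t+1}$-measurable. Let $g_{1,i}(t)\in\partial_1f_{1,i}(v_{1,i}(t),u_{2,i}(t))$ and $g_{2,i}(t)\in\partial_2f_{2,i}(u_{1,i}(t),v_{2,i}(t))$.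 Put $\Lambda_l=\max_{i\in\mathcal V_l}\|x_{l,i}(0)\|$. *Assumptions.* (A1) There is $L>0$ with $|f_{l,i}(x_1,x_2)-f_{l,i}(x_1',x_2')|\le L(\|x_1-x_1'\|+\|x_2-x_2'\|)$ on $O_1\times O_2$ for all $l,i$. (A2) There are $\nu_l>0$ with $\mathbb E[\hat g_{l,i}(t)\mid\mathcal F_t]=g_{l,i}(t)$ and $\mathbb E[\|g_{l,i}(t)-\hat g_{l,i}(t)\|_*^2\mid\mathcal F_t]\le\nu_l^2$ for all $l,i,t$. (A3) $D_{\psi_l}(x,y)$ is convex in $y\in X_l$, and $D_{\psi_l}(x_k,x)\to0$ whenever $x_k\to x$ in $X_l$. **Theorem.** Assume that $R_1^2:=\max\{D_{\psi_1}(x_1,x_1'):x_1,x_1'\in X_1\}$ exists. Then for every agent $i\in\mathcal V_1$ and every $T$ with $\alpha(T)>0$, the pseudo regret $$\bar R_1^{(i)}(T)=\mathbb E\Big[\sum_{t=1}^TU(x_{1,i}(t),u_{2,i}(t))\Big]-\min_{x_1\in X_1}\mathbb E\Big[\sum_{t=1}^TU(x_1,u_{2,i}(t))\Big]$$ satisfies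 $$\begin{aligned}\bar R_1^{(i)}(T)\le{}&\sum_{t=1}^T\sum_{l=1}^2(L+\nu_l)(9L+\nu_l)\alpha(t-1)+4L\sum_{t=1}^T\sum_{l=1}^2n_l\Gamma_l(L+\nu_l)\sum_{s=1}^{t-1}\theta_l^{t-1-s}\alpha(s-1)\\&+4L\sum_{t=1}^T\sum_{l=1}^2n_l\Gamma_l\theta_l^{t-1}\Lambda_l+\frac{R_1^2}{\alpha(T)}.\end{aligned}$$ -/

import Mathlib

open MeasureTheory ProbabilityTheory Filter Topology

noncomputable section

/-! The two networks are indexed by `l : Fin 2`; the index `0` is the first network and `1` the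
second one. A strategy profile is `z : ∀ l, E l`. -/

/-- The Bregman divergence of `ψ` on `X`. For `x, p ∈ X` with `X` convex and `ψ` differentiable
on `X`, the value of any derivative within `X` at `p` in the direction `x - p` is the same. -/
def bregman {E : Type*} [NormedAddCommGroup E] [NormedSpace ℝ E]
    (X : Set E) (ψ : E → ℝ) (x p : E) : ℝ :=
  ψ x - ψ p - fderivWithin ℝ ψ X p (x - p)

/-- `z` is a value of the prox-mapping: a minimizer over `x' ∈ X` of `⟨y, x - x'⟩ + D(x', x)`. -/
def IsProx {E : Type*} [NormedAddCommGroup E] [NormedSpace ℝ E]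
    (X : Set E) (ψ : E → ℝ) (x : E) (y : StrongDual ℝ E) (z : E) : Prop :=
  z ∈ X ∧ IsMinOn (fun x' => y (x - x') + bregman X ψ x' x) X z

/-- A differentiable regularizer on `X`, `1`-strongly convex for the norm of `E`. -/
structure IsRegularizer {E : Type*} [NormedAddCommGroup E] [NormedSpace ℝ E]
    (X : Set E) (ψ : E → ℝ) : Prop where
  differentiableOn : DifferentiableOn ℝ ψ X
  strongConvexOn : StrongConvexOn X 1 ψ

/-- The partial subdifferential at `z`, with respect to the coordinate `l`, of a function `h`
defined on the product of the sets `O k`. -/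
def partialSubdiff {E : Fin 2 → Type*} [∀ l, NormedAddCommGroup (E l)]
    [∀ l, NormedSpace ℝ (E l)] (O : ∀ l, Set (E l)) (l : Fin 2)
    (h : (∀ k, E k) → ℝ) (z : ∀ k, E k) : Set (StrongDual ℝ (E l)) :=
  {g | ∀ y ∈ O l, h z + g (y - z l) ≤ h (Function.update z l y)}

/-- The expected cost `E[Ψ(z; ξ)]`. -/
def expectedCost {E : Fin 2 → Type*} {Ω : Type*} [MeasurableSpace Ω] (P : Measure Ω) {d : ℕ}
    (ξ : Ω → Fin d → ℝ) (Ψ : (∀ k, E k) → (Fin d → ℝ) → ℝ) (z : ∀ k, E k) : ℝ :=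
  ∫ ω, Ψ z (ξ ω) ∂P

/-- The cost function of the game, the average of the costs in the first network. -/
def gameCost {E : Fin 2 → Type*} {n : Fin 2 → ℕ}
    (f : ∀ l, Fin (n l) → (∀ k, E k) → ℝ) (z : ∀ k, E k) : ℝ :=
  (1 / (n 0 : ℝ)) * ∑ i, f 0 i z

/-- A two-network zero-sum game with agent costs `f l i`. The strategy sets `X l` are compact and
convex, and the costs are defined on the product of open sets `O l ⊇ X l`. -/
structure IsTwoNetworkGame {E : Fin 2 → Type*} [∀ l, NormedAddCommGroup (E l)]
    [∀ l, NormedSpace ℝ (E l)] {n : Fin 2 → ℕ} (X O : ∀ l, Set (E l))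
    (f : ∀ l, Fin (n l) → (∀ k, E k) → ℝ) : Prop where
  compact : ∀ l, IsCompact (X l)
  convex : ∀ l, Convex ℝ (X l)
  isOpen : ∀ l, IsOpen (O l)
  subset : ∀ l, X l ⊆ O l
  /-- each cost is convex in the strategy of the agent's own network -/
  convexOn : ∀ l i, ∀ z : ∀ k, E k, (∀ k, z k ∈ X k) →
    ConvexOn ℝ (X l) (fun y => f l i (Function.update z l y))
  /-- and concave in the strategy of the other one -/
  concaveOn : ∀ l i, ∀ z : ∀ k, E k, (∀ k, z k ∈ X k) → ∀ k, k ≠ l →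
    ConcaveOn ℝ (X k) (fun y => f l i (Function.update z k y))
  zeroSum : ∀ z : ∀ k, E k, (∀ k, z k ∈ X k) →
    gameCost f z = -((1 / (n 1 : ℝ)) * ∑ j, f 1 j z)

/-- Mixing matrices of one network: `W t` is doubly stochastic with weights at least `η` exactly
on the edges of `G t` (`Adj j i` is the edge from `j` to `i`), every agent is its own neighbour,
and the union of any `B` consecutive graphs is strongly connected. -/
structure IsNetworkMixing {n : ℕ} (η : ℝ) (B : ℕ) (G : ℕ → Digraph (Fin n))
    (W : ℕ → Matrix (Fin n) (Fin n) ℝ) : Prop where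
  selfLoop : ∀ t i, (G t).Adj i i
  weight_ge : ∀ t i j, (G t).Adj j i → η ≤ W t i j
  weight_eq_zero : ∀ t i j, ¬ (G t).Adj j i → W t i j = 0
  row_sum : ∀ t i, ∑ j, W t i j = 1
  col_sum : ∀ t j, ∑ i, W t i j = 1
  connected : ∀ k i j,
    Relation.ReflTransGen (fun a b => ∃ t, k ≤ t ∧ t < k + B ∧ (G t).Adj a b) i j

/-- Mixing matrices between the networks: `W l k t i j`, for `l ≠ k`, is the weight that the agent
`i` of the network `l` gives to the agent `j` of the network `k`. -/
structure IsCrossMixing {n : Fin 2 → ℕ} (G : ℕ → Digraph (Σ l, Fin (n l)))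
    (W : ∀ l k : Fin 2, ℕ → Matrix (Fin (n l)) (Fin (n k)) ℝ) : Prop where
  nonneg : ∀ l k, l ≠ k → ∀ t i j, 0 ≤ W l k t i j
  edge : ∀ l k, l ≠ k → ∀ t i j, 0 < W l k t i j → (G t).Adj ⟨k, j⟩ ⟨l, i⟩
  row_sum : ∀ l k, l ≠ k → ∀ t i, ∑ j, W l k t i j = 1

/-- The weighted averages formed by the agent `i` of the network `l` at time `t`. Its coordinate
`l` is `v_{l,i}(t)`, its other coordinate `k` is `u_{k,i}(t)`. -/
def averages {E : Fin 2 → Type*} [∀ l, NormedAddCommGroup (E l)] [∀ l, NormedSpace ℝ (E l)]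
    {Ω : Type*} {n : Fin 2 → ℕ} (W : ∀ l k : Fin 2, ℕ → Matrix (Fin (n l)) (Fin (n k)) ℝ)
    (x : ∀ l, Fin (n l) → ℕ → Ω → E l) (l : Fin 2) (i : Fin (n l)) (t : ℕ) (ω : Ω) :
    ∀ k, E k :=
  fun k => ∑ j, W l k t i j • x k j t ω

/-- The σ-algebra generated by the initial states and by the samples at the times `s < t`. -/
abbrev history {E : Fin 2 → Type*} [∀ l, MeasurableSpace (E l)] {Ω : Type*} {n : Fin 2 → ℕ} {d : ℕ}
    (x : ∀ l, Fin (n l) → ℕ → Ω → E l) (ξs : ∀ l, Fin (n l) → ℕ → Ω → Fin d → ℝ) (t : ℕ) :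
    MeasurableSpace Ω :=
  (⨆ l, ⨆ i, MeasurableSpace.comap (x l i 0) inferInstance) ⊔
    ⨆ l, ⨆ i, ⨆ s, ⨆ _ : s < t, MeasurableSpace.comap (ξs l i s) inferInstance

/-- The samples are independent and identically distributed copies of `ξ`. -/
structure IsIIDSample {Ω : Type*} [MeasurableSpace Ω] (P : Measure Ω) {n : Fin 2 → ℕ} {d : ℕ}
    (ξ : Ω → Fin d → ℝ) (ξs : ∀ l, Fin (n l) → ℕ → Ω → Fin d → ℝ) : Prop where
  measurable_source : Measurable ξ
  measurable : ∀ l i t, Measurable (ξs l i t)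
  indep : iIndepFun (fun (p : (Σ l, Fin (n l)) × ℕ) => ξs p.1.1 p.1.2 p.2) P
  identDistrib : ∀ l i t, IdentDistrib (ξs l i t) ξ P P

/-- The states `x` and the sampled subgradients `ghat` are generated by distributed stochastic
mirror descent with step sizes `α`, mixing matrices `W`, regularizers `ψ` and initial states `x₀`;
the sampled subgradient of time `t` is determined measurably by the information up to time `t`. -/
structure IsDSMD {E : Fin 2 → Type*} [∀ l, NormedAddCommGroup (E l)] [∀ l, NormedSpace ℝ (E l)]
    [∀ l, MeasurableSpace (E l)] {Ω : Type*} {n : Fin 2 → ℕ} {d : ℕ}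
    (X O : ∀ l, Set (E l)) (ψ : ∀ l, E l → ℝ)
    (Ψ : ∀ l, Fin (n l) → (∀ k, E k) → (Fin d → ℝ) → ℝ)
    (W : ∀ l k : Fin 2, ℕ → Matrix (Fin (n l)) (Fin (n k)) ℝ) (α : ℕ → ℝ)
    (ξs : ∀ l, Fin (n l) → ℕ → Ω → Fin d → ℝ) (x₀ : ∀ l, Fin (n l) → E l)
    (x : ∀ l, Fin (n l) → ℕ → Ω → E l)
    (ghat : ∀ l, Fin (n l) → ℕ → Ω → StrongDual ℝ (E l)) : Prop where
  init_mem : ∀ l i, x₀ l i ∈ X l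
  init : ∀ l i ω, x l i 0 ω = x₀ l i
  sample : ∀ l i t ω, ghat l i t ω ∈
    partialSubdiff O l (fun z => Ψ l i z (ξs l i t ω)) (averages W x l i t ω)
  sample_measurable : ∀ l i t, StronglyMeasurable[history x ξs (t + 1)] (ghat l i t)
  update : ∀ l i t ω, IsProx (X l) (ψ l) (averages W x l i t ω l) (-(α t • ghat l i t ω))
    (x l i (t + 1) ω)

/-- Lipschitz continuity of all agent costs on the product of the sets `O l`. -/
def LipschitzCosts {E : Fin 2 → Type*} [∀ l, NormedAddCommGroup (E l)] {n : Fin 2 → ℕ}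
    (O : ∀ l, Set (E l)) (f : ∀ l, Fin (n l) → (∀ k, E k) → ℝ) (L : ℝ) : Prop :=
  ∀ l i, ∀ z z' : ∀ k, E k, (∀ k, z k ∈ O k) → (∀ k, z' k ∈ O k) →
    |f l i z - f l i z'| ≤ L * (‖z 0 - z' 0‖ + ‖z 1 - z' 1‖)

/-- Given the past, the sampled subgradients `ghat` have conditional mean `g` and conditional
variance (in the dual norm) at most `ν l ^ 2`. -/
structure UnbiasedBoundedVariance {E : Fin 2 → Type*} [∀ l, NormedAddCommGroup (E l)]
    [∀ l, NormedSpace ℝ (E l)] {Ω : Type*} [MeasurableSpace Ω] (P : Measure Ω) {n : Fin 2 → ℕ}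
    (ℱ : ℕ → MeasurableSpace Ω) (ghat g : ∀ l, Fin (n l) → ℕ → Ω → StrongDual ℝ (E l))
    (ν : Fin 2 → ℝ) : Prop where
  integrable : ∀ l i t, Integrable (ghat l i t) P
  unbiased : ∀ l i t, P[ghat l i t | ℱ t] =ᵐ[P] g l i t
  integrable_sq : ∀ l i t, Integrable (fun ω => ‖g l i t ω - ghat l i t ω‖ ^ 2) P
  variance_le : ∀ l i t,
    P[fun ω => ‖g l i t ω - ghat l i t ω‖ ^ 2 | ℱ t] ≤ᵐ[P] fun _ => ν l ^ 2

/-- Convexity of the Bregman divergence in its second argument, and Bregman reciprocity. -/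
structure BregmanConvexReciprocal {E : Type*} [NormedAddCommGroup E] [NormedSpace ℝ E]
    (X : Set E) (ψ : E → ℝ) : Prop where
  convexOn : ∀ x ∈ X, ConvexOn ℝ X (fun y => bregman X ψ x y)
  reciprocity : ∀ x ∈ X, ∀ xs : ℕ → E, (∀ k, xs k ∈ X) → Tendsto xs atTop (𝓝 x) →
    Tendsto (fun k => bregman X ψ (xs k) x) atTop (𝓝 0)

/-- The pseudo regret up to time `T`, for the decisions `xi t` in the first network against the
received profiles `z t`, of which only the coordinate `1` matters. -/
def pseudoRegret {E : Fin 2 → Type*} {Ω : Type*} [MeasurableSpace Ω] (P : Measure Ω)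
    (X : ∀ l, Set (E l)) (U : (∀ k, E k) → ℝ) (xi : ℕ → Ω → E 0) (z : ℕ → Ω → ∀ k, E k)
    (T : ℕ) : ℝ :=
  (∫ ω, ∑ t ∈ Finset.Icc 1 T, U (Function.update (z t ω) 0 (xi t ω)) ∂P) -
    sInf ((fun x₁ => ∫ ω, ∑ t ∈ Finset.Icc 1 T, U (Function.update (z t ω) 0 x₁) ∂P) '' X 0)

/-- The constant `Γ = (1 - η / (4 n²))⁻²`. -/
def mixGamma (η : ℝ) (n : ℕ) : ℝ := (1 - η / (4 * (n : ℝ) ^ 2)) ^ (-2 : ℤ)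

/-- The rate `θ = (1 - η / (4 n²)) ^ (1 / B)`. -/
def mixTheta (η : ℝ) (n B : ℕ) : ℝ := (1 - η / (4 * (n : ℝ) ^ 2)) ^ (1 / (B : ℝ))

end

/-! Fix a competitor `q` in `X 0`; a bound uniform in `q` bounds the regret against the minimum.
Writing `v j`, `u j` for the averages seen by agent `j` of the first network, each difference `f 0 j
(x i, u i) - f 0 j (q, u i)` is at most the linear term `⟨g j, v j - q⟩` plus `L` times distances
between points of the same network (`gameCost_sub_le`). So the regret splits into a mirror-descent
part and a disagreement part.

Mirror-descent part. Since `v j - q` is determined by the past, `g j` may be replaced by the sampled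
subgradient in expectation (`integral_apply_eq_of_condExp`). Along each realization the three-point
inequality gives a descent estimate for every agent. Double stochasticity and convexity of the
divergence in its second argument show that mixing does not increase the total divergence to `q`, so
the estimates telescope, up to the varying step size, to `R₁ ^ 2 / α T` plus squared subgradient
norms (`sum_linearized_regret_le`).

Disagreement part. The states follow an averaging recursion perturbed by prox steps of length at
most `α t * ‖ghat‖` (`IsProx.norm_sub_le`). Unrolling it, the distance to the network mean is
controlled by how fast products of mixing matrices approach `1 / n` (`norm_sub_mean_le`). Averages
within or between networks inherit these bounds.

The rate comes from a cut argument. A doubly stochastic step lowers the sum of squares by half the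
weighted pairwise dispersions of its rows. Sort the values at time `k`: each gap between consecutive
values separates two groups, and the first weight crossing between them produces dispersion at least
`η` times the squared gap. Clamping to the gaps lets these contributions be added without double
counting. For vectors of sum zero the squared gaps control the sum of squares, which hence shrinks
by the factor `1 - η / (2 n²)` over `B` steps (`IsUniformMixing.sum_sq_window_le`). -/

/-! ### Contraction of doubly stochastic mixing -/

section Mixing

variable {n : ℕ}

/-- Expansion of the pairwise dispersion of `x` under the weights `w`. -/
theorem sum_mul_mul_sub_sq {ι : Type*} [Fintype ι] (w x : ι → ℝ) (hw : ∑ i, w i = 1) :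
    ∑ i, ∑ j, w i * w j * (x i - x j) ^ 2 = 2 * ∑ i, w i * x i ^ 2 - 2 * (∑ i, w i * x i) ^ 2 := by
  have h : ∀ i j, w i * w j * (x i - x j) ^ 2 =
      w j * (w i * x i ^ 2) + w i * (w j * x j ^ 2) - 2 * ((w i * x i) * (w j * x j)) := by
    intro i j; ring
  simp only [h, Finset.sum_add_distrib, Finset.sum_sub_distrib, ← Finset.mul_sum,
    ← Finset.sum_mul, hw]
  ring

/-- The decrease of the sum of squares under a doubly stochastic matrix. -/
theorem sum_sq_sub_sum_mulVec_sq {ι : Type*} [Fintype ι] (A : Matrix ι ι ℝ)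
    (hrow : ∀ i, ∑ j, A i j = 1) (hcol : ∀ j, ∑ i, A i j = 1) (x : ι → ℝ) :
    ∑ r, ∑ i, ∑ j, A r i * A r j * (x i - x j) ^ 2 =
      2 * (∑ i, x i ^ 2 - ∑ i, (A.mulVec x) i ^ 2) := by
  simp only [fun r => sum_mul_mul_sub_sq (A r) x (hrow r), Finset.sum_sub_distrib,
    ← Finset.mul_sum, Matrix.mulVec, dotProduct]
  rw [Finset.sum_comm]
  simp only [← Finset.sum_mul, hcol, one_mul]
  ring

/-- Each summand is the length of the part of `[y d, y (d + 1)]` lying below `a`; the intervals are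
adjacent, so the lengths add up to the part of `[y 0, y m]` below `a`. -/
theorem sum_clamp_succ (y : ℕ → ℝ) (hy : Monotone y) (a : ℝ) (m : ℕ) :
    ∑ d ∈ Finset.range m, (max (y d) (min a (y (d + 1))) - y d) =
      max (y 0) (min a (y m)) - y 0 := by
  induction m with
  | zero => simp
  | succ m ih =>
    rw [Finset.sum_range_succ, ih]
    have h0 := hy (Nat.zero_le m)
    have h1 := hy (Nat.le_succ m)
    rcases le_total a (y 0) with h | h
    · rw [min_eq_left (by linarith), min_eq_left (by linarith), max_eq_left h,
        max_eq_left (by linarith)]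
      ring
    · rcases le_total a (y m) with h' | h'
      · rw [min_eq_left h', min_eq_left (by linarith), max_eq_left h']
        ring
      · rw [min_eq_right h', max_eq_right h0, max_eq_right (a := y m) (le_min h' h1),
          max_eq_right (a := y 0) (le_min h (by linarith))]
        ring

/-- Clamping to consecutive intervals splits a square distance. -/
theorem sum_clamp_sub_sq_le (y : ℕ → ℝ) (hy : Monotone y) (a b : ℝ) (m : ℕ) :
    ∑ d ∈ Finset.range m, (max (y d) (min a (y (d + 1))) - max (y d) (min b (y (d + 1)))) ^ 2 ≤
      (a - b) ^ 2 := by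
  wlog hab : b ≤ a generalizing a b
  · have := this b a (le_of_not_ge hab)
    simpa only [sub_sq_comm] using this
  have hnn : ∀ d ∈ Finset.range m,
      0 ≤ max (y d) (min a (y (d + 1))) - max (y d) (min b (y (d + 1))) := fun d _ =>
    sub_nonneg.2 (max_le_max le_rfl (min_le_min hab le_rfl))
  -- All differences have the same sign, so the squares sum to at most the square of the sum, and
  -- that sum is the difference of the clamps to the whole interval `[y 0, y m]`.
  refine (Finset.sum_sq_le_sq_sum_of_nonneg hnn).trans ?_
  refine pow_le_pow_left₀ (Finset.sum_nonneg hnn) ?_ 2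
  have h : ∑ d ∈ Finset.range m,
      (max (y d) (min a (y (d + 1))) - max (y d) (min b (y (d + 1)))) =
      max (y 0) (min a (y m)) - max (y 0) (min b (y m)) := by
    have ha := sum_clamp_succ y hy a m
    have hb := sum_clamp_succ y hy b m
    rw [Finset.sum_sub_distrib] at ha hb ⊢
    linarith
  rw [h]
  rcases le_total a (y m) with h1 | h1
  · rw [min_eq_left h1, min_eq_left (hab.trans h1)]
    rcases le_total a (y 0) with h2 | h2
    · rw [max_eq_left h2, max_eq_left (hab.trans h2)]; linarith
    · rw [max_eq_right h2]; linarith [le_max_right (y 0) b]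
  · rw [min_eq_right h1, max_eq_right (hy (Nat.zero_le m))]
    have := le_max_right (y 0) (min b (y m))
    rcases le_total b (y m) with h2 | h2
    · rw [min_eq_left h2] at *; linarith
    · rw [min_eq_right h2] at *; linarith

/-- Doubly stochastic matrices whose nonzero entries are at least `η`, with nonzero diagonal, such
that within any `B` consecutive steps every proper subset receives from its complement. -/
structure IsUniformMixing (η : ℝ) (B : ℕ) (W : ℕ → Matrix (Fin n) (Fin n) ℝ) : Prop where
  nonneg : ∀ t i j, 0 ≤ W t i j
  diag_ge : ∀ t i, η ≤ W t i i
  ge_of_ne_zero : ∀ t i j, W t i j ≠ 0 → η ≤ W t i j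
  row_sum : ∀ t i, ∑ j, W t i j = 1
  col_sum : ∀ t j, ∑ i, W t i j = 1
  exists_cross : ∀ k (S : Set (Fin n)), S.Nonempty → Sᶜ.Nonempty →
    ∃ t, k ≤ t ∧ t < k + B ∧ ∃ i ∈ S, ∃ j ∈ Sᶜ, W t i j ≠ 0

theorem exists_edge_of_reflTransGen {α : Type*} {r : α → α → Prop} {S : Set α} {a b : α}
    (h : Relation.ReflTransGen r a b) (ha : a ∉ S) (hb : b ∈ S) :
    ∃ i ∉ S, ∃ j ∈ S, r i j := by
  induction h with
  | refl => exact absurd hb ha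
  | @tail b c _ hbc ih =>
    by_cases hbS : b ∈ S
    · exact ih hbS
    · exact ⟨b, hbS, c, hb, hbc⟩

theorem IsNetworkMixing.isUniformMixing {η : ℝ} (hη : 0 < η) {B : ℕ} {G : ℕ → Digraph (Fin n)}
    {W : ℕ → Matrix (Fin n) (Fin n) ℝ} (h : IsNetworkMixing η B G W) : IsUniformMixing η B W where
  nonneg t i j := by
    by_cases hA : (G t).Adj j i
    · exact hη.le.trans (h.weight_ge t i j hA)
    · exact (h.weight_eq_zero t i j hA).ge
  diag_ge t i := h.weight_ge t i i (h.selfLoop t i)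
  ge_of_ne_zero t i j hne := h.weight_ge t i j (by
    by_contra hA
    exact hne (h.weight_eq_zero t i j hA))
  row_sum := h.row_sum
  col_sum := h.col_sum
  exists_cross k S := by
    rintro ⟨b, hb⟩ ⟨a, ha⟩
    obtain ⟨i, hi, j, hj, t, h1, h2, hA⟩ := exists_edge_of_reflTransGen (h.connected k a b) ha hb
    exact ⟨t, h1, h2, j, hj, i, hi, ne_of_gt (hη.trans_le (h.weight_ge t j i hA))⟩

/-- A row that gives weight at least `η` to both sides of a cut has a large dispersion across it. -/
theorem le_dispersion_of_cut (w : Fin n → ℝ) (hw : ∀ i, 0 ≤ w i) (hw1 : ∑ i, w i = 1) {η a b : ℝ}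
    (hη : 0 < η) (S : Set (Fin n)) (φ : Fin n → ℝ) (hS : ∀ i ∈ S, φ i = a) (hSc : ∀ i ∉ S, φ i = b)
    {p q : Fin n} (hp : p ∈ S) (hq : q ∉ S) (hwp : η ≤ w p) (hwq : η ≤ w q) :
    η * (b - a) ^ 2 ≤ ∑ i, ∑ j, w i * w j * (φ i - φ j) ^ 2 := by
  classical
  -- `c` is the weight off `S`. As `φ` takes only two values, the dispersion is exactly `2 c (1 - c)
  -- (b - a) ^ 2`.
  set c : ℝ := ∑ i, if i ∈ S then 0 else w i with hc
  have hcq : η ≤ c := by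
    refine hwq.trans ?_
    have := Finset.single_le_sum (f := fun i => if i ∈ S then 0 else w i)
      (fun i _ => by split_ifs; exacts [le_rfl, hw i]) (Finset.mem_univ q)
    simpa [hq] using this
  have hcp : η ≤ 1 - c := by
    have h1 : 1 - c = ∑ i, if i ∈ S then w i else 0 := by
      rw [hc, ← hw1, ← Finset.sum_sub_distrib]
      refine Finset.sum_congr rfl fun i _ => ?_
      split_ifs <;> simp
    rw [h1]
    refine hwp.trans ?_
    have := Finset.single_le_sum (f := fun i => if i ∈ S then w i else 0)
      (fun i _ => by split_ifs; exacts [hw i, le_rfl]) (Finset.mem_univ p)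
    simpa [hp] using this
  have h1 : ∑ i, w i * φ i = a + (b - a) * c := by
    rw [hc, Finset.mul_sum]
    calc ∑ i, w i * φ i = ∑ i, (w i * a + (b - a) * if i ∈ S then 0 else w i) := by
          refine Finset.sum_congr rfl fun i _ => ?_
          split_ifs with h
          · rw [hS i h]; ring
          · rw [hSc i h]; ring
      _ = _ := by rw [Finset.sum_add_distrib, ← Finset.sum_mul, hw1, one_mul]
  have h2 : ∑ i, w i * φ i ^ 2 = a ^ 2 + (b ^ 2 - a ^ 2) * c := by
    rw [hc, Finset.mul_sum]
    calc ∑ i, w i * φ i ^ 2 = ∑ i, (w i * a ^ 2 + (b ^ 2 - a ^ 2) * if i ∈ S then 0 else w i) := by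
          refine Finset.sum_congr rfl fun i _ => ?_
          split_ifs with h
          · rw [hS i h]; ring
          · rw [hSc i h]; ring
      _ = _ := by rw [Finset.sum_add_distrib, ← Finset.sum_mul, hw1, one_mul]
  rw [sum_mul_mul_sub_sq w φ hw1, h1, h2]
  have h3 : 2 * (a ^ 2 + (b ^ 2 - a ^ 2) * c) - 2 * (a + (b - a) * c) ^ 2 =
      (2 * (c * (1 - c))) * (b - a) ^ 2 := by ring
  rw [h3]
  refine mul_le_mul_of_nonneg_right ?_ (sq_nonneg _)
  -- One of `c`, `1 - c` is at least `1 / 2` and the other at least `η`, whence `2 c (1 - c) ≥ η`.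
  rcases le_total c (1 / 2) with h | h
  · nlinarith
  · nlinarith

/-- If two groups are separated by the interval `[a, b]`, then within `B` steps some mixing step
has a large dispersion across this interval. -/
theorem IsUniformMixing.exists_dispersion_ge {η : ℝ} (hη : 0 < η) {B : ℕ}
    {W : ℕ → Matrix (Fin n) (Fin n) ℝ} (hW : IsUniformMixing η B W) (x : ℕ → Fin n → ℝ)
    (hx : ∀ t, x (t + 1) = (W t).mulVec (x t)) (k : ℕ) (S : Set (Fin n)) (hS : S.Nonempty)
    (hS' : Sᶜ.Nonempty) {a b : ℝ} (hab : a ≤ b) (ha : ∀ i ∈ S, x k i ≤ a)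
    (hb : ∀ i ∉ S, b ≤ x k i) :
    ∃ t ∈ Finset.Ico k (k + B), η * (b - a) ^ 2 ≤
      ∑ r, ∑ i, ∑ j, W t r i * W t r j *
        (max a (min (x t i) b) - max a (min (x t j) b)) ^ 2 := by
  classical
  -- `Nat.find hex` is the first delay at which a nonzero weight joins the two sides, in either
  -- direction.
  have hex : ∃ s, ∃ i j, (i ∈ S ↔ j ∉ S) ∧ W (k + s) i j ≠ 0 := by
    obtain ⟨t, h1, -, i, hi, j, hj, hne⟩ := hW.exists_cross k S hS hS'
    refine ⟨t - k, i, j, by simp_all, ?_⟩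
    rwa [Nat.add_sub_cancel' h1]
  have hlt : Nat.find hex < B := by
    obtain ⟨t, h1, h2, i, hi, j, hj, hne⟩ := hW.exists_cross k S hS hS'
    refine (Nat.find_min' hex (m := t - k) ⟨i, j, by simp_all, ?_⟩).trans_lt (by omega)
    rwa [Nat.add_sub_cancel' h1]
  -- Before the first crossing every agent averages only over its own side, so the two groups stay
  -- separated by `[a, b]`.
  have hinv : ∀ s ≤ Nat.find hex,
      (∀ i ∈ S, x (k + s) i ≤ a) ∧ (∀ i ∉ S, b ≤ x (k + s) i) := by
    intro s
    induction s with
    | zero => exact fun _ => ⟨ha, hb⟩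
    | succ s ih =>
      intro hs
      obtain ⟨h1, h2⟩ := ih (by omega)
      have hno := Nat.find_min hex (m := s) (by omega)
      push Not at hno
      rw [← add_assoc, hx]
      constructor
      · intro i hi
        calc (W (k + s)).mulVec (x (k + s)) i = ∑ j, W (k + s) i j * x (k + s) j := rfl
          _ ≤ ∑ j, W (k + s) i j * a := by
              refine Finset.sum_le_sum fun j _ => ?_
              by_cases hj : j ∈ S
              · exact mul_le_mul_of_nonneg_left (h1 j hj) (hW.nonneg _ _ _)
              · simp [hno i j (by simp [hi, hj])]
          _ = a := by rw [← Finset.sum_mul, hW.row_sum, one_mul]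
      · intro i hi
        calc b = ∑ j, W (k + s) i j * b := by rw [← Finset.sum_mul, hW.row_sum, one_mul]
          _ ≤ ∑ j, W (k + s) i j * x (k + s) j := by
              refine Finset.sum_le_sum fun j _ => ?_
              by_cases hj : j ∈ S
              · simp [hno i j (by simp [hi, hj])]
              · exact mul_le_mul_of_nonneg_left (h2 j hj) (hW.nonneg _ _ _)
  obtain ⟨h1, h2⟩ := hinv _ le_rfl
  obtain ⟨r, q, hrq, hne⟩ := Nat.find_spec hex
  set t := k + Nat.find hex with ht
  refine ⟨t, Finset.mem_Ico.2 ⟨by omega, by omega⟩, ?_⟩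
  have hφ1 : ∀ i ∈ S, max a (min (x t i) b) = a := fun i hi =>
    max_eq_left ((min_le_left _ _).trans (h1 i hi))
  have hφ2 : ∀ i ∉ S, max a (min (x t i) b) = b := fun i hi => by
    rw [min_eq_right (h2 i hi), max_eq_right hab]
  have hrow : η * (b - a) ^ 2 ≤ ∑ i, ∑ j, W t r i * W t r j *
      (max a (min (x t i) b) - max a (min (x t j) b)) ^ 2 := by
    -- Row `r` has weight at least `η` on both sides: its diagonal entry on its own side, the
    -- crossing entry on the other.
    by_cases hr : r ∈ S
    · exact le_dispersion_of_cut (W t r) (hW.nonneg t r) (hW.row_sum t r) hη S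
        (fun i => max a (min (x t i) b)) hφ1 hφ2 hr
        (hrq.1 hr) (hW.diag_ge t r) (hW.ge_of_ne_zero t r q hne)
    · have hq : q ∈ S := by
        by_contra hq
        exact hr (hrq.2 hq)
      exact le_dispersion_of_cut (W t r) (hW.nonneg t r) (hW.row_sum t r) hη S
        (fun i => max a (min (x t i) b)) hφ1 hφ2 hq
        hr (hW.ge_of_ne_zero t r q hne) (hW.diag_ge t r)
  refine hrow.trans (Finset.single_le_sum (f := fun r => ∑ i, ∑ j, W t r i * W t r j *
      (max a (min (x t i) b) - max a (min (x t j) b)) ^ 2) (fun r _ => ?_) (Finset.mem_univ r))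
  exact Finset.sum_nonneg fun i _ => Finset.sum_nonneg fun j _ =>
    mul_nonneg (mul_nonneg (hW.nonneg _ _ _) (hW.nonneg _ _ _)) (sq_nonneg _)

/-- A real vector with sum zero has a small sum of squares if consecutive gaps of its sorted
values are small. -/
theorem sum_sq_le_of_gaps (y : ℕ → ℝ) (x : Fin n → ℝ) (h0 : ∑ i, x i = 0)
    (hlo : ∀ i, y 0 ≤ x i) (hhi : ∀ i, x i ≤ y (n - 1)) :
    ∑ i, x i ^ 2 ≤ (n : ℝ) ^ 2 * ∑ d ∈ Finset.range (n - 1), (y (d + 1) - y d) ^ 2 := by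
  rcases Nat.eq_zero_or_pos n with rfl | hn
  · simp
  have hn' : (0 : ℝ) < n := by exact_mod_cast hn
  -- With sum zero, `0` lies between `y 0` and `y (n - 1)`, so every `|x i|` is at most the range.
  -- Cauchy–Schwarz over the gaps costs one factor `n`; the number of coordinates gives the other.
  have hy0 : y 0 ≤ 0 := by
    have : ∑ _i : Fin n, y 0 ≤ ∑ i, x i := Finset.sum_le_sum fun i _ => hlo i
    simp only [Finset.sum_const, Finset.card_univ, Fintype.card_fin, nsmul_eq_mul, h0] at this
    by_contra h
    push Not at h
    linarith [mul_pos hn' h]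
  have hy1 : 0 ≤ y (n - 1) := by
    have : ∑ i, x i ≤ ∑ _i : Fin n, y (n - 1) := Finset.sum_le_sum fun i _ => hhi i
    simp only [Finset.sum_const, Finset.card_univ, Fintype.card_fin, nsmul_eq_mul, h0] at this
    by_contra h
    push Not at h
    linarith [mul_neg_of_pos_of_neg hn' h]
  have hgap : (y (n - 1) - y 0) ^ 2 ≤ n * ∑ d ∈ Finset.range (n - 1), (y (d + 1) - y d) ^ 2 := by
    rw [← Finset.sum_range_sub y]
    refine sq_sum_le_card_mul_sum_sq.trans ?_
    refine mul_le_mul_of_nonneg_right ?_ (Finset.sum_nonneg fun _ _ => sq_nonneg _)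
    rw [Finset.card_range]
    exact_mod_cast Nat.sub_le n 1
  calc ∑ i, x i ^ 2 ≤ ∑ _i : Fin n, (y (n - 1) - y 0) ^ 2 := by
        refine Finset.sum_le_sum fun i _ => ?_
        have := hlo i
        have := hhi i
        rw [sq_le_sq, abs_le]
        rw [abs_of_nonneg (by linarith)]
        constructor <;> linarith
    _ = n * (y (n - 1) - y 0) ^ 2 := by simp
    _ ≤ n * (n * ∑ d ∈ Finset.range (n - 1), (y (d + 1) - y d) ^ 2) :=
        mul_le_mul_of_nonneg_left hgap hn'.le
    _ = _ := by ring

/-- On vectors with sum zero, the sum of squares contracts within `B` mixing steps. -/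
theorem IsUniformMixing.sum_sq_window_le {η : ℝ} (hη : 0 < η) {B : ℕ}
    {W : ℕ → Matrix (Fin n) (Fin n) ℝ} (hW : IsUniformMixing η B W) (x : ℕ → Fin n → ℝ)
    (hx : ∀ t, x (t + 1) = (W t).mulVec (x t)) (k : ℕ) (h0 : ∑ i, x k i = 0) :
    ∑ i, x (k + B) i ^ 2 ≤ (1 - η / (2 * (n : ℝ) ^ 2)) * ∑ i, x k i ^ 2 := by
  rcases Nat.eq_zero_or_pos n with rfl | hn
  · simp
  have hn' : (0 : ℝ) < n := by exact_mod_cast hn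
  set σ := Tuple.sort (x k)
  have hσ : Monotone (x k ∘ σ) := Tuple.monotone_sort (x k)
  -- Ranks beyond `n - 1` are truncated, so that `y`, the values sorted at time `k`, is a monotone
  -- sequence on all of `ℕ`.
  let e : ℕ → Fin n := fun d => ⟨min d (n - 1), by omega⟩
  let y : ℕ → ℝ := fun d => x k (σ (e d))
  have hy : Monotone y := fun c d hcd => hσ (by
    change min c (n - 1) ≤ min d (n - 1)
    exact min_le_min hcd le_rfl)
  -- The gaps are frozen at time `k` while `x t` moves. Clamping lets one mixing step pay for
  -- several gaps at once: their dispersions add up to at most the full dispersion of that step.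
  have hstep : ∀ t, ∑ d ∈ Finset.range (n - 1), ∑ r, ∑ i, ∑ j, W t r i * W t r j *
      (max (y d) (min (x t i) (y (d + 1))) - max (y d) (min (x t j) (y (d + 1)))) ^ 2 ≤
      2 * (∑ i, x t i ^ 2 - ∑ i, x (t + 1) i ^ 2) := by
    intro t
    rw [hx t, ← sum_sq_sub_sum_mulVec_sq (W t) (hW.row_sum t) (hW.col_sum t), Finset.sum_comm]
    refine Finset.sum_le_sum fun r _ => ?_
    rw [Finset.sum_comm]
    refine Finset.sum_le_sum fun i _ => ?_
    rw [Finset.sum_comm]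
    refine Finset.sum_le_sum fun j _ => ?_
    rw [← Finset.mul_sum]
    exact mul_le_mul_of_nonneg_left (sum_clamp_sub_sq_le y hy _ _ _)
      (mul_nonneg (hW.nonneg _ _ _) (hW.nonneg _ _ _))
  have htel : ∑ t ∈ Finset.Ico k (k + B), 2 * (∑ i, x t i ^ 2 - ∑ i, x (t + 1) i ^ 2) =
      2 * (∑ i, x k i ^ 2 - ∑ i, x (k + B) i ^ 2) := by
    rw [← Finset.mul_sum, Finset.sum_Ico_eq_sum_range, Nat.add_sub_cancel_left]
    congr 1
    simpa only [add_assoc, add_zero] using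
      Finset.sum_range_sub' (fun s => ∑ i, x (k + s) i ^ 2) B
  have hcut : ∀ d ∈ Finset.range (n - 1), η * (y (d + 1) - y d) ^ 2 ≤
      ∑ t ∈ Finset.Ico k (k + B), ∑ r, ∑ i, ∑ j, W t r i * W t r j *
      (max (y d) (min (x t i) (y (d + 1))) - max (y d) (min (x t j) (y (d + 1)))) ^ 2 := by
    intro d hd
    rw [Finset.mem_range] at hd
    -- The cut consists of the agents of rank at most `d` at time `k`, whose values are separated
    -- from the others by `[y d, y (d + 1)]`.
    obtain ⟨t, ht, h⟩ := hW.exists_dispersion_ge hη x hx k {i | ((σ.symm i : Fin n) : ℕ) ≤ d}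
      ⟨σ (e d), by simp [e]⟩ ⟨σ (e (d + 1)), by simp [e]; omega⟩ (hy (Nat.le_succ d))
      (fun i hi => by
        have := hσ (a := σ.symm i) (b := e d) (by
          change ((σ.symm i : Fin n) : ℕ) ≤ min d (n - 1)
          have := (σ.symm i).2
          have hi' : ((σ.symm i : Fin n) : ℕ) ≤ d := hi
          omega)
        simpa using this)
      (fun i hi => by
        have := hσ (a := e (d + 1)) (b := σ.symm i) (by
          change min (d + 1) (n - 1) ≤ ((σ.symm i : Fin n) : ℕ)
          have hi' : ¬ ((σ.symm i : Fin n) : ℕ) ≤ d := hi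
          omega)
        simpa using this)
    refine h.trans (Finset.single_le_sum (f := fun t => ∑ r, ∑ i, ∑ j, W t r i * W t r j *
      (max (y d) (min (x t i) (y (d + 1))) - max (y d) (min (x t j) (y (d + 1)))) ^ 2)
      (fun t _ => ?_) ht)
    exact Finset.sum_nonneg fun r _ => Finset.sum_nonneg fun i _ => Finset.sum_nonneg fun j _ =>
      mul_nonneg (mul_nonneg (hW.nonneg _ _ _) (hW.nonneg _ _ _)) (sq_nonneg _)
  have hsum : η * ∑ d ∈ Finset.range (n - 1), (y (d + 1) - y d) ^ 2 ≤
      2 * (∑ i, x k i ^ 2 - ∑ i, x (k + B) i ^ 2) := by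
    rw [Finset.mul_sum, ← htel]
    refine (Finset.sum_le_sum hcut).trans ?_
    rw [Finset.sum_comm]
    exact Finset.sum_le_sum fun t _ => hstep t
  have hgaps := sum_sq_le_of_gaps y (x k) h0
    (fun i => by
      have := hσ (a := e 0) (b := σ.symm i) (by change min 0 (n - 1) ≤ _; simp)
      simpa using this)
    (fun i => by
      have := hσ (a := σ.symm i) (b := e (n - 1)) (by
        change ((σ.symm i : Fin n) : ℕ) ≤ min (n - 1) (n - 1)
        have := (σ.symm i).2
        omega)
      simpa using this)
  have h2 : η / (2 * (n : ℝ) ^ 2) * ∑ i, x k i ^ 2 ≤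
      η / 2 * ∑ d ∈ Finset.range (n - 1), (y (d + 1) - y d) ^ 2 := by
    refine (mul_le_mul_of_nonneg_left hgaps (by positivity)).trans (le_of_eq ?_)
    field_simp
  linarith

end Mixing

/-! ### Transition matrices -/

section Transition

variable {n : ℕ}

/-- The product of `m` consecutive mixing matrices, starting at time `s`. -/
def transition (W : ℕ → Matrix (Fin n) (Fin n) ℝ) (s : ℕ) : ℕ → Matrix (Fin n) (Fin n) ℝ
  | 0 => 1
  | m + 1 => W (s + m) * transition W s m

theorem transition_col_sum {W : ℕ → Matrix (Fin n) (Fin n) ℝ} (hcol : ∀ t j, ∑ i, W t i j = 1)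
    (s m : ℕ) (j : Fin n) : ∑ i, transition W s m i j = 1 := by
  induction m with
  | zero => simp [transition, Matrix.one_apply]
  | succ m ih =>
    simp only [transition, Matrix.mul_apply]
    rw [Finset.sum_comm]
    simp only [← Finset.sum_mul, hcol, one_mul, ih]

theorem IsUniformMixing.shift {η : ℝ} {B : ℕ} {W : ℕ → Matrix (Fin n) (Fin n) ℝ}
    (hW : IsUniformMixing η B W) (s : ℕ) : IsUniformMixing η B (fun t => W (s + t)) where
  nonneg t := hW.nonneg (s + t)
  diag_ge t := hW.diag_ge (s + t)
  ge_of_ne_zero t := hW.ge_of_ne_zero (s + t)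
  row_sum t := hW.row_sum (s + t)
  col_sum t := hW.col_sum (s + t)
  exists_cross k S h h' := by
    obtain ⟨t, h1, h2, H⟩ := hW.exists_cross (s + k) S h h'
    refine ⟨t - s, by omega, by omega, ?_⟩
    rwa [Nat.add_sub_cancel' (by omega)]

theorem IsUniformMixing.sum_sq_succ_le {η : ℝ} {B : ℕ} {W : ℕ → Matrix (Fin n) (Fin n) ℝ}
    (hW : IsUniformMixing η B W) (t : ℕ) (x : Fin n → ℝ) :
    ∑ i, ((W t).mulVec x) i ^ 2 ≤ ∑ i, x i ^ 2 := by
  have h := sum_sq_sub_sum_mulVec_sq (W t) (hW.row_sum t) (hW.col_sum t) x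
  have h' : 0 ≤ ∑ r, ∑ i, ∑ j, W t r i * W t r j * (x i - x j) ^ 2 :=
    Finset.sum_nonneg fun r _ => Finset.sum_nonneg fun i _ => Finset.sum_nonneg fun j _ =>
      mul_nonneg (mul_nonneg (hW.nonneg _ _ _) (hW.nonneg _ _ _)) (sq_nonneg _)
  linarith

theorem mixBase_pos {η : ℝ} (hη0 : 0 < η) (hη1 : η < 1) (hn : 1 ≤ n) :
    0 < 1 - η / (4 * (n : ℝ) ^ 2) ∧ 1 - η / (4 * (n : ℝ) ^ 2) < 1 := by
  have hn' : (1 : ℝ) ≤ n := by exact_mod_cast hn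
  have h1 : η / (4 * (n : ℝ) ^ 2) < 1 := by
    rw [div_lt_one (by positivity)]
    nlinarith
  have h2 : 0 < η / (4 * (n : ℝ) ^ 2) := by positivity
  constructor <;> linarith

theorem mixTheta_pos {η : ℝ} (hη0 : 0 < η) (hη1 : η < 1) (hn : 1 ≤ n) (B : ℕ) :
    0 < mixTheta η n B :=
  Real.rpow_pos_of_pos (mixBase_pos hη0 hη1 hn).1 _

theorem mixTheta_le_one {η : ℝ} (hη0 : 0 < η) (hη1 : η < 1) (hn : 1 ≤ n) (B : ℕ) :
    mixTheta η n B ≤ 1 :=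
  Real.rpow_le_one (mixBase_pos hη0 hη1 hn).1.le (mixBase_pos hη0 hη1 hn).2.le (by positivity)

theorem mixGamma_pos {η : ℝ} (hη0 : 0 < η) (hη1 : η < 1) (hn : 1 ≤ n) : 0 < mixGamma η n :=
  zpow_pos (mixBase_pos hη0 hη1 hn).1 _

/-- Rounding `m / B` down loses less than one full block, which costs at most one factor `(1 - η /
(4 n²))⁻¹`; `mixGamma` supplies two. -/
theorem mixBase_pow_le {η : ℝ} (hη0 : 0 < η) (hη1 : η < 1) (hn : 1 ≤ n) {B : ℕ} (hB : 1 ≤ B)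
    (m : ℕ) : (1 - η / (4 * (n : ℝ) ^ 2)) ^ (m / B) ≤ mixGamma η n * mixTheta η n B ^ m := by
  obtain ⟨h0, h1⟩ := mixBase_pos hη0 hη1 hn
  unfold mixGamma mixTheta
  set β := 1 - η / (4 * (n : ℝ) ^ 2)
  rw [← Real.rpow_natCast (β ^ (1 / (B : ℝ))), ← Real.rpow_mul h0.le, ← Real.rpow_intCast,
    ← Real.rpow_add h0, ← Real.rpow_natCast]
  refine Real.rpow_le_rpow_of_exponent_ge h0 h1.le ?_
  have hB' : (0 : ℝ) < B := by exact_mod_cast hB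
  have hm : (m : ℝ) ≤ B * ((m / B : ℕ) : ℝ) + B := by
    have := Nat.lt_mul_div_succ m hB
    rw [mul_add, mul_one] at this
    exact_mod_cast this.le
  have hm' : 1 / (B : ℝ) * m ≤ ((m / B : ℕ) : ℝ) + 1 := by
    rw [one_div_mul_eq_div, div_le_iff₀ hB']
    linarith
  push_cast
  linarith

/-- The transition matrices approach the averaging matrix geometrically. -/
theorem IsUniformMixing.abs_transition_sub_le {η : ℝ} (hη0 : 0 < η) (hη1 : η < 1) (hn : 1 ≤ n)
    {B : ℕ} (hB : 1 ≤ B) {W : ℕ → Matrix (Fin n) (Fin n) ℝ} (hW : IsUniformMixing η B W)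
    (s m : ℕ) (i j : Fin n) :
    |transition W s m i j - 1 / n| ≤ mixGamma η n * mixTheta η n B ^ m := by
  obtain ⟨hβ0, hβ1⟩ := mixBase_pos hη0 hη1 hn
  refine le_trans ?_ (mixBase_pow_le hη0 hη1 hn hB m)
  have hn' : (0 : ℝ) < n := by exact_mod_cast hn
  -- For fixed `j`, the column `j` minus `1 / n` has sum zero and evolves by the mixing matrices
  -- from time `s` on, so the window contraction applies. Its initial sum of squares is `1 - 1 / n`.
  set x : ℕ → Fin n → ℝ := fun t i => transition W s t i j - 1 / n with hxdef
  have hx : ∀ t, x (t + 1) = (W (s + t)).mulVec (x t) := by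
    intro t
    funext i
    simp only [hxdef, transition, Matrix.mulVec, dotProduct, Matrix.mul_apply, mul_sub,
      Finset.sum_sub_distrib, ← Finset.sum_mul, hW.row_sum, one_mul]
  have h0 : ∀ t, ∑ i, x t i = 0 := by
    intro t
    simp [hxdef, Finset.sum_sub_distrib, transition_col_sum hW.col_sum, hn'.ne']
  have hinit : ∑ i, x 0 i ^ 2 ≤ 1 := by
    have : ∀ i, x 0 i ^ 2 = (if i = j then 1 - 2 * (1 / (n : ℝ)) else 0) + (1 / (n : ℝ)) ^ 2 := by
      intro i
      simp only [hxdef, transition, Matrix.one_apply]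
      split_ifs <;> ring
    simp only [this, Finset.sum_add_distrib, Finset.sum_ite_eq', Finset.mem_univ, if_true,
      Finset.sum_const, Finset.card_univ, Fintype.card_fin, nsmul_eq_mul]
    have : (n : ℝ) * (1 / (n : ℝ)) ^ 2 = 1 / n := by field_simp
    rw [this]
    have : 0 < 1 / (n : ℝ) := by positivity
    linarith
  -- The contraction factor for squares is at most the square of the base `1 - η / (4 n²)`; this is
  -- where the `4` comes from.
  have hc : 1 - η / (2 * (n : ℝ) ^ 2) ≤ (1 - η / (4 * (n : ℝ) ^ 2)) ^ 2 := by
    have : η / (2 * (n : ℝ) ^ 2) = 2 * (η / (4 * (n : ℝ) ^ 2)) := by field_simp; norm_num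
    rw [this]
    nlinarith [sq_nonneg (η / (4 * (n : ℝ) ^ 2))]
  have hblock : ∀ q, ∑ i, x (q * B) i ^ 2 ≤ ((1 - η / (4 * (n : ℝ) ^ 2)) ^ q) ^ 2 := by
    intro q
    induction q with
    | zero => simpa using hinit
    | succ q ih =>
      rw [add_mul, one_mul]
      refine ((hW.shift s).sum_sq_window_le hη0 x hx (q * B) (h0 _)).trans ?_
      calc (1 - η / (2 * (n : ℝ) ^ 2)) * ∑ i, x (q * B) i ^ 2
          ≤ (1 - η / (4 * (n : ℝ) ^ 2)) ^ 2 * ((1 - η / (4 * (n : ℝ) ^ 2)) ^ q) ^ 2 :=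
            mul_le_mul hc ih (Finset.sum_nonneg fun _ _ => sq_nonneg _) (sq_nonneg _)
        _ = _ := by ring
  have hmono : ∀ r k, ∑ i, x (k + r) i ^ 2 ≤ ∑ i, x k i ^ 2 := by
    intro r k
    induction r with
    | zero => exact le_rfl
    | succ r ih =>
      rw [← add_assoc, hx]
      exact ((hW.shift s).sum_sq_succ_le (k + r) _).trans ih
  have hfin : x m i ^ 2 ≤ ((1 - η / (4 * (n : ℝ) ^ 2)) ^ (m / B)) ^ 2 := by
    refine (Finset.single_le_sum (f := fun i => x m i ^ 2) (fun i _ => sq_nonneg _)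
      (Finset.mem_univ i)).trans ?_
    -- The `m / B` full blocks contract, and the remaining `m % B` steps do not increase the sum of
    -- squares.
    have := hmono (m % B) (m / B * B)
    rw [Nat.div_add_mod'] at this
    exact this.trans (hblock _)
  exact abs_le_of_sq_le_sq hfin (by positivity)

/-- The solution of a perturbed averaging recursion. -/
theorem perturbed_mixing_eq {E : Type*} [AddCommGroup E] [Module ℝ E]
    (W : ℕ → Matrix (Fin n) (Fin n) ℝ) (x e : ℕ → Fin n → E)
    (hx : ∀ t i, x (t + 1) i = ∑ j, W t i j • x t j + e t i) (t : ℕ) (i : Fin n) :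
    x t i = ∑ j, transition W 0 t i j • x 0 j +
      ∑ s ∈ Finset.range t, ∑ j, transition W (s + 1) (t - 1 - s) i j • e s j := by
  induction t generalizing i with
  | zero => simp [transition, Matrix.one_apply]
  | succ t ih =>
    have hassoc : ∀ (s m : ℕ) (y : Fin n → E), ∑ j, transition W s (m + 1) i j • y j =
        ∑ k, W (s + m) i k • ∑ j, transition W s m k j • y j := by
      intro s m y
      simp only [transition, Matrix.mul_apply, Finset.sum_smul, Finset.smul_sum, smul_smul]
      rw [Finset.sum_comm]
    rw [hx, Finset.sum_range_succ, hassoc, zero_add]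
    -- The newest perturbation has not been mixed: its transition matrix has length `0`.
    have hlast : ∑ j, transition W (t + 1) (t + 1 - 1 - t) i j • e t j = e t i := by
      simp [transition, Matrix.one_apply]
    have hmid : ∑ s ∈ Finset.range t, ∑ j, transition W (s + 1) (t + 1 - 1 - s) i j • e s j =
        ∑ k, W t i k • ∑ s ∈ Finset.range t, ∑ j, transition W (s + 1) (t - 1 - s) k j • e s j := by
      simp only [Finset.smul_sum (s := Finset.range t)]
      refine Eq.trans (Finset.sum_congr rfl fun s hs => ?_) Finset.sum_comm
      rw [Finset.mem_range] at hs
      have h1 : t + 1 - 1 - s = (t - 1 - s) + 1 := by omega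
      rw [h1, hassoc]
      have h2 : s + 1 + (t - 1 - s) = t := by omega
      rw [h2]
    rw [hlast, hmid, ← add_assoc, ← Finset.sum_add_distrib]
    congr 1
    refine Finset.sum_congr rfl fun k _ => ?_
    rw [← smul_add, ← ih k]

/-- The mean of a perturbed averaging recursion. -/
theorem perturbed_mixing_mean {E : Type*} [AddCommGroup E] [Module ℝ E]
    (W : ℕ → Matrix (Fin n) (Fin n) ℝ) (hcol : ∀ t j, ∑ i, W t i j = 1) (x e : ℕ → Fin n → E)
    (hx : ∀ t i, x (t + 1) i = ∑ j, W t i j • x t j + e t i) (t : ℕ) :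
    ∑ i, x t i = ∑ j, x 0 j + ∑ s ∈ Finset.range t, ∑ j, e s j := by
  induction t with
  | zero => simp
  | succ t ih =>
    simp only [hx, Finset.sum_add_distrib]
    rw [Finset.sum_comm]
    simp only [← Finset.sum_smul, hcol, one_smul, ih, Finset.sum_range_succ, add_assoc]

/-- Distance to the mean in a perturbed averaging recursion. -/
theorem norm_sub_mean_le {E : Type*} [NormedAddCommGroup E] [NormedSpace ℝ E]
    (W : ℕ → Matrix (Fin n) (Fin n) ℝ) (hcol : ∀ t j, ∑ i, W t i j = 1) (x e : ℕ → Fin n → E)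
    (hx : ∀ t i, x (t + 1) i = ∑ j, W t i j • x t j + e t i) (t : ℕ) (i : Fin n) :
    ‖x t i - (1 / (n : ℝ)) • ∑ j, x t j‖ ≤ ∑ j, |transition W 0 t i j - 1 / n| * ‖x 0 j‖ +
      ∑ s ∈ Finset.range t, ∑ j, |transition W (s + 1) (t - 1 - s) i j - 1 / n| * ‖e s j‖ := by
  have h : x t i - (1 / (n : ℝ)) • ∑ j, x t j =
      ∑ j, (transition W 0 t i j - 1 / n) • x 0 j +
      ∑ s ∈ Finset.range t, ∑ j, (transition W (s + 1) (t - 1 - s) i j - 1 / n) • e s j := by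
    rw [perturbed_mixing_mean W hcol x e hx t, perturbed_mixing_eq W x e hx t i]
    simp only [sub_smul, Finset.sum_sub_distrib, smul_add, Finset.smul_sum]
    abel
  rw [h]
  refine (norm_add_le _ _).trans (add_le_add ?_ ?_)
  · refine (norm_sum_le _ _).trans_eq ?_
    simp only [norm_smul, Real.norm_eq_abs]
  · refine (norm_sum_le _ _).trans (Finset.sum_le_sum fun s _ => ?_)
    refine (norm_sum_le _ _).trans_eq ?_
    simp only [norm_smul, Real.norm_eq_abs]

end Transition

/-! ### Bregman divergences and the prox-mapping -/

section Prox

variable {E : Type*} [NormedAddCommGroup E] [NormedSpace ℝ E] {X : Set E} {ψ : E → ℝ}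

theorem add_inv_succ_smul_sub_mem (hX : Convex ℝ X) {p q : E} (hp : p ∈ X) (hq : q ∈ X)
    (k : ℕ) : p + ((k : ℝ) + 1)⁻¹ • (q - p) ∈ X :=
  hX.add_smul_sub_mem hp hq ⟨by positivity,
    inv_le_one_of_one_le₀ (by linarith [k.cast_nonneg (α := ℝ)])⟩

/-- The derivative within a convex set, in a feasible direction, as a limit of quotients. -/
theorem tendsto_fderivWithin_apply_sub (hX : Convex ℝ X) (hψ : DifferentiableOn ℝ ψ X) {p q : E}
    (hp : p ∈ X) (hq : q ∈ X) :
    Tendsto (fun k : ℕ => ((k : ℝ) + 1) * (ψ (p + ((k : ℝ) + 1)⁻¹ • (q - p)) - ψ p)) atTop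
      (𝓝 (fderivWithin ℝ ψ X p (q - p))) := by
  -- The quotient limit determines the value in a feasible direction for any choice of derivative
  -- within `X`, so `X` may have empty interior.
  have h := (hψ p hp).hasFDerivWithinAt
  have hinv : Tendsto (fun k : ℕ => ((k : ℝ) + 1)⁻¹) atTop (𝓝 0) := by
    simpa only [one_div] using tendsto_one_div_add_atTop_nhds_zero_nat (𝕜 := ℝ)
  refine h.lim (c := fun k : ℕ => (k : ℝ) + 1) (d := fun k : ℕ => ((k : ℝ) + 1)⁻¹ • (q - p))
    (by simpa using hinv.smul_const (q - p))
    (Eventually.of_forall fun k => add_inv_succ_smul_sub_mem hX hp hq k) ?_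
  · refine tendsto_const_nhds.congr fun k => ?_
    rw [smul_smul, mul_inv_cancel₀ (by positivity), one_smul]

/-- Strong convexity at `p + τ (x - p)` with `τ = 1 / (k + 1)`, divided by `τ`, bounds the
difference quotient; letting `k → ∞` turns it into the derivative term of the divergence. -/
theorem IsRegularizer.half_norm_sub_sq_le_bregman (hX : Convex ℝ X) (hψ : IsRegularizer X ψ)
    {x p : E} (hx : x ∈ X) (hp : p ∈ X) : 1 / 2 * ‖x - p‖ ^ 2 ≤ bregman X ψ x p := by
  have hlim := tendsto_fderivWithin_apply_sub hX hψ.differentiableOn hp hx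
  have hinv : Tendsto (fun k : ℕ => ((k : ℝ) + 1)⁻¹) atTop (𝓝 0) := by
    simpa only [one_div] using tendsto_one_div_add_atTop_nhds_zero_nat (𝕜 := ℝ)
  have hlim2 : Tendsto (fun k : ℕ => ψ x - ψ p - (1 - ((k : ℝ) + 1)⁻¹) * (1 / 2 * ‖x - p‖ ^ 2))
      atTop (𝓝 (ψ x - ψ p - (1 - 0) * (1 / 2 * ‖x - p‖ ^ 2))) :=
    tendsto_const_nhds.sub ((tendsto_const_nhds.sub hinv).mul_const _)
  have hle := le_of_tendsto_of_tendsto' hlim hlim2 fun k => by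
    set τ : ℝ := ((k : ℝ) + 1)⁻¹ with hτ
    have hk : (0 : ℝ) < (k : ℝ) + 1 := by positivity
    have hτ0 : 0 ≤ τ := by positivity
    have hτ1 : τ ≤ 1 := inv_le_one_of_one_le₀ (by linarith [k.cast_nonneg (α := ℝ)])
    have hsc := hψ.strongConvexOn.2 hp hx (show 0 ≤ 1 - τ by linarith) hτ0 (by ring)
    have hpt : (1 - τ) • p + τ • x = p + τ • (x - p) := by module
    rw [hpt, norm_sub_rev p x] at hsc
    simp only [smul_eq_mul] at hsc
    have : ψ (p + τ • (x - p)) - ψ p ≤ τ * (ψ x - ψ p - (1 - τ) * (1 / 2 * ‖x - p‖ ^ 2)) := by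
      linarith
    calc ((k : ℝ) + 1) * (ψ (p + τ • (x - p)) - ψ p)
        ≤ ((k : ℝ) + 1) * (τ * (ψ x - ψ p - (1 - τ) * (1 / 2 * ‖x - p‖ ^ 2))) :=
          mul_le_mul_of_nonneg_left this hk.le
      _ = _ := by rw [← mul_assoc, hτ, mul_inv_cancel₀ hk.ne', one_mul]
  unfold bregman
  linarith

/-- The three-point inequality of the prox-mapping. -/
theorem IsProx.three_point (hX : Convex ℝ X) (hψ : IsRegularizer X ψ) {v z q : E}
    {y : StrongDual ℝ E} (h : IsProx X ψ v y z) (hq : q ∈ X) :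
    bregman X ψ z v + bregman X ψ q z + y (q - z) ≤ bregman X ψ q v := by
  have hlim := tendsto_fderivWithin_apply_sub hX hψ.differentiableOn h.1 hq
  -- First-order optimality of `z` in the feasible direction `q - z`, obtained by comparing `z` with
  -- nearby points of the segment towards `q`.
  have hle : y (q - z) + fderivWithin ℝ ψ X v (q - z) ≤ fderivWithin ℝ ψ X z (q - z) := by
    refine ge_of_tendsto' hlim fun k => ?_
    set τ : ℝ := ((k : ℝ) + 1)⁻¹ with hτ
    have hk : (0 : ℝ) < (k : ℝ) + 1 := by positivity
    have hmin := h.2 (add_inv_succ_smul_sub_mem hX h.1 hq k)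
    rw [← hτ] at hmin
    simp only [Set.mem_ofPred_eq, bregman] at hmin
    have e1 : v - (z + τ • (q - z)) = (v - z) - τ • (q - z) := by abel
    have e2 : z + τ • (q - z) - v = (z - v) + τ • (q - z) := by abel
    rw [e1, e2, map_sub y (v - z), map_add, map_smul, map_smul, smul_eq_mul, smul_eq_mul] at hmin
    have : τ * (y (q - z) + fderivWithin ℝ ψ X v (q - z)) ≤ ψ (z + τ • (q - z)) - ψ z := by
      linarith
    calc y (q - z) + fderivWithin ℝ ψ X v (q - z)
        = ((k : ℝ) + 1) * (τ * (y (q - z) + fderivWithin ℝ ψ X v (q - z))) := by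
          rw [← mul_assoc, hτ, mul_inv_cancel₀ hk.ne', one_mul]
      _ ≤ _ := mul_le_mul_of_nonneg_left this hk.le
  unfold bregman
  have e3 : q - v = (q - z) + (z - v) := by abel
  rw [e3, map_add]
  linarith

theorem bregman_self (x : E) : bregman X ψ x x = 0 := by simp [bregman]

/-- The prox-mapping moves a point by at most the dual norm of the step. -/
theorem IsProx.norm_sub_le (hX : Convex ℝ X) (hψ : IsRegularizer X ψ) {v z : E}
    {y : StrongDual ℝ E} (h : IsProx X ψ v y z) (hv : v ∈ X) : ‖z - v‖ ≤ ‖y‖ := by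
  -- Taking `v` itself as competitor leaves `D(z, v) + D(v, z) ≤ y (z - v)`; the two divergences
  -- together are at least `‖z - v‖ ^ 2`.
  have h1 := h.three_point hX hψ hv
  have h2 := hψ.half_norm_sub_sq_le_bregman hX h.1 hv
  have h3 := hψ.half_norm_sub_sq_le_bregman hX hv h.1
  have h4 : y (z - v) ≤ ‖y‖ * ‖z - v‖ := (le_abs_self _).trans (y.le_opNorm _)
  rw [bregman_self] at h1
  rw [norm_sub_rev v z] at h3
  have h5 : y (v - z) = -y (z - v) := by rw [← map_neg, neg_sub]
  by_contra hlt
  push Not at hlt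
  nlinarith [norm_nonneg y, norm_nonneg (z - v)]

/-- The descent inequality of one mirror step. -/
theorem IsProx.descent (hX : Convex ℝ X) (hψ : IsRegularizer X ψ) {v z q : E}
    {y : StrongDual ℝ E} (h : IsProx X ψ v y z) (hv : v ∈ X) (hq : q ∈ X) :
    y (q - v) ≤ bregman X ψ q v - bregman X ψ q z + 1 / 2 * ‖y‖ ^ 2 := by
  have h1 := h.three_point hX hψ hq
  have h2 := hψ.half_norm_sub_sq_le_bregman hX h.1 hv
  have h4 : y (z - v) ≤ ‖y‖ * ‖z - v‖ := (le_abs_self _).trans (y.le_opNorm _)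
  have e3 : q - v = (q - z) + (z - v) := by abel
  rw [e3, map_add]
  -- Young's inequality for `‖y‖ * ‖z - v‖`; the term `‖z - v‖ ^ 2 / 2` is absorbed by `D(z, v)`.
  nlinarith [sq_nonneg (‖y‖ - ‖z - v‖)]

/-- Quadratic growth of the prox objective around its minimizer. -/
theorem IsProx.growth (hX : Convex ℝ X) (hψ : IsRegularizer X ψ) {v z q : E}
    {y : StrongDual ℝ E} (h : IsProx X ψ v y z) (hq : q ∈ X) :
    1 / 2 * ‖q - z‖ ^ 2 ≤ (y (v - q) + bregman X ψ q v) - (y (v - z) + bregman X ψ z v) := by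
  have h1 := h.three_point hX hψ hq
  have h2 := hψ.half_norm_sub_sq_le_bregman hX hq h.1
  have e3 : v - z = (v - q) + (q - z) := by abel
  rw [e3, map_add]
  linarith

end Prox

/-! ### Telescoping of mirror descent over a network -/

section Descent

/-- Summation by parts. The induction keeps the term `-A (T + 1)`: since `M - A (T + 1)` is
nonnegative, `1 / α T` may be enlarged to `1 / α (T + 1)`, after which the next summand telescopes.
-/
theorem sum_sub_div_le {A α : ℕ → ℝ} {M : ℝ} (hAM : ∀ t, A t ≤ M)
    (hα : Antitone α) (T : ℕ) (hT : 0 < α T) :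
    ∑ t ∈ Finset.Icc 1 T, (A t - A (t + 1)) / α t ≤ (M - A (T + 1)) / α T := by
  induction T with
  | zero => simpa using div_nonneg (sub_nonneg.2 (hAM 1)) hT.le
  | succ T ih =>
    have hT' : 0 < α T := hT.trans_le (hα (Nat.le_succ T))
    rw [Finset.sum_Icc_succ_top (by omega)]
    have h1 : (M - A (T + 1)) / α T ≤ (M - A (T + 1)) / α (T + 1) :=
      div_le_div_of_nonneg_left (sub_nonneg.2 (hAM _)) hT (hα (Nat.le_succ T))
    calc _ ≤ (M - A (T + 1)) / α (T + 1) + (A (T + 1) - A (T + 1 + 1)) / α (T + 1) := by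
          linarith [ih hT']
      _ = _ := by rw [← add_div]; congr 1; ring

/-- The regret inequality of distributed mirror descent along one realization. -/
theorem sum_linearized_regret_le {E : Type*} [NormedAddCommGroup E] [NormedSpace ℝ E] {X : Set E}
    {ψ : E → ℝ} (hX : Convex ℝ X) (hψ : IsRegularizer X ψ)
    (hconv : ∀ q ∈ X, ConvexOn ℝ X (fun y => bregman X ψ q y)) {n : ℕ}
    {W : ℕ → Matrix (Fin n) (Fin n) ℝ} (hW0 : ∀ t i j, 0 ≤ W t i j)
    (hrow : ∀ t i, ∑ j, W t i j = 1) (hcol : ∀ t j, ∑ i, W t i j = 1)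
    {α : ℕ → ℝ} (hα : Antitone α) {x v : ℕ → Fin n → E} (hxX : ∀ t i, x t i ∈ X)
    (hv : ∀ t i, v t i = ∑ j, W t i j • x t j) {g : ℕ → Fin n → StrongDual ℝ E}
    (hprox : ∀ t i, IsProx X ψ (v t i) (-(α t • g t i)) (x (t + 1) i)) {M : ℝ}
    (hM : ∀ y ∈ X, ∀ y' ∈ X, bregman X ψ y y' ≤ M) {q : E} (hq : q ∈ X) (T : ℕ) (hT : 0 < α T) :
    ∑ t ∈ Finset.Icc 1 T, ∑ i, g t i (v t i - q) ≤
      n * M / α T + ∑ t ∈ Finset.Icc 1 T, ∑ i, α t / 2 * ‖g t i‖ ^ 2 := by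
  have hvX : ∀ t i, v t i ∈ X := fun t i => by
    rw [hv]
    exact hX.sum_mem (fun j _ => hW0 t i j) (hrow t i) fun j _ => hxX t j
  set A : ℕ → ℝ := fun t => ∑ i, bregman X ψ q (x t i) with hA
  have hA0 : ∀ t, 0 ≤ A t := fun t => Finset.sum_nonneg fun i _ =>
    le_trans (by positivity) (hψ.half_norm_sub_sq_le_bregman hX hq (hxX t i))
  have hAM : ∀ t, A t ≤ n * M := fun t => by
    calc A t ≤ ∑ _i : Fin n, M := Finset.sum_le_sum fun i _ => hM q hq _ (hxX t i)
      _ = n * M := by simp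
  -- Mixing does not increase the total divergence to `q`: convexity in the second argument with the
  -- row sums, then the column sums.
  have hjensen : ∀ t, ∑ i, bregman X ψ q (v t i) ≤ A t := fun t => by
    calc ∑ i, bregman X ψ q (v t i) ≤ ∑ i, ∑ j, W t i j * bregman X ψ q (x t j) := by
          refine Finset.sum_le_sum fun i _ => ?_
          rw [hv]
          exact (hconv q hq).map_sum_le (fun j _ => hW0 t i j) (hrow t i) fun j _ => hxX t j
      _ = A t := by
          rw [Finset.sum_comm]
          simp only [← Finset.sum_mul, hcol, one_mul, hA]
  have hstep : ∀ t ∈ Finset.Icc 1 T, ∑ i, g t i (v t i - q) ≤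
      (A t - A (t + 1)) / α t + ∑ i, α t / 2 * ‖g t i‖ ^ 2 := by
    intro t ht
    have hαt : 0 < α t := hT.trans_le (hα (Finset.mem_Icc.1 ht).2)
    have h1 : ∀ i, α t * g t i (v t i - q) ≤ bregman X ψ q (v t i) - bregman X ψ q (x (t + 1) i) +
        α t * (α t / 2 * ‖g t i‖ ^ 2) := by
      intro i
      have := (hprox t i).descent hX hψ (hvX t i) hq
      rw [norm_neg, norm_smul, Real.norm_of_nonneg hαt.le] at this
      have e : (-(α t • g t i)) (q - v t i) = α t * g t i (v t i - q) := by
        rw [← neg_sub (v t i) q, map_neg]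
        simp
      rw [e] at this
      linarith
    have h2 : α t * ∑ i, g t i (v t i - q) ≤
        A t - A (t + 1) + α t * ∑ i, α t / 2 * ‖g t i‖ ^ 2 := by
      rw [Finset.mul_sum, Finset.mul_sum]
      refine (Finset.sum_le_sum fun i _ => h1 i).trans ?_
      rw [Finset.sum_add_distrib, Finset.sum_sub_distrib]
      have := hjensen t
      simp only [hA] at this ⊢
      linarith
    have h3 : (A t - A (t + 1)) / α t + ∑ i, α t / 2 * ‖g t i‖ ^ 2 =
        (A t - A (t + 1) + α t * ∑ i, α t / 2 * ‖g t i‖ ^ 2) / α t := by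
      field_simp
    rw [h3, le_div_iff₀ hαt]
    linarith
  refine (Finset.sum_le_sum hstep).trans ?_
  rw [Finset.sum_add_distrib]
  refine add_le_add ((sum_sub_div_le hAM hα T hT).trans ?_) le_rfl
  exact div_le_div_of_nonneg_right (by linarith [hA0 (T + 1)]) hT.le

end Descent

/-! ### Measurability of the iterates -/

section Measurability

variable {E : Type*} [NormedAddCommGroup E] {Ω : Type*} {m : MeasurableSpace Ω}

/-- A function continuous on `X` composed with a strongly measurable function with values in
`X`. -/
theorem ContinuousOn.comp_stronglyMeasurable_of_mem {F : Type*} [TopologicalSpace F] {β : Type*}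
    [TopologicalSpace β] {X : Set F} {h : F → β} (hh : ContinuousOn h X)
    {v : Ω → F} (hv : StronglyMeasurable v) [TopologicalSpace.PseudoMetrizableSpace F]
    [MeasurableSpace F] [BorelSpace F] [SecondCountableTopology F]
    [TopologicalSpace.PseudoMetrizableSpace β] (hvX : ∀ ω, v ω ∈ X) :
    StronglyMeasurable fun ω => h (v ω) := by
  have h1 : StronglyMeasurable (fun ω => (⟨v ω, hvX ω⟩ : X)) :=
    (hv.measurable.subtype_mk).stronglyMeasurable
  exact (continuousOn_iff_continuous_domRestrict.1 hh).comp_stronglyMeasurable h1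

/-- A minimizer with quadratic growth of a measurable family of continuous functions is
measurable. -/
theorem measurable_of_quadratic_growth [MeasurableSpace E] [BorelSpace E]
    [SecondCountableTopology E] {X : Set E} (F : Ω → E → ℝ)
    (hF : ∀ q ∈ X, Measurable fun ω => F ω q) (hcont : ∀ ω, ContinuousOn (F ω) X) (z : Ω → E)
    (hz : ∀ ω, z ω ∈ X) (hgrow : ∀ ω, ∀ q ∈ X, 1 / 2 * ‖q - z ω‖ ^ 2 ≤ F ω q - F ω (z ω)) :
    Measurable z := by
  refine measurable_of_isClosed fun C hC => ?_
  obtain ⟨D, hDX, hDc, hD⟩ := (TopologicalSpace.IsSeparable.of_separableSpace X).exists_countable_dense_subset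
  obtain ⟨D', hDX', hDc', hD'⟩ :=
    (TopologicalSpace.IsSeparable.of_separableSpace (X ∩ C)).exists_countable_dense_subset
  -- Quadratic growth makes `z ω ∈ C` equivalent to near-optimal points existing in `C` at every
  -- precision; continuity restricts the test to countable dense sets.
  have hset : z ⁻¹' C = ⋂ q ∈ D, ⋂ k : ℕ, ⋃ p ∈ D', {ω | F ω p ≤ F ω q + 1 / ((k : ℝ) + 1)} := by
    ext ω
    simp only [Set.mem_preimage, Set.mem_iInter, Set.mem_iUnion, Set.mem_ofPred_eq, exists_prop]
    have happrox : ∀ (S Q : Set E), S ⊆ X → Q ⊆ S → S ⊆ closure Q → ∀ y ∈ S, ∀ ε > 0,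
        ∃ p ∈ Q, F ω p < F ω y + ε := by
      intro S Q hS hQ hcl y hy ε hε
      have hc : ContinuousWithinAt (F ω) Q y := (hcont ω y (hS hy)).mono (hQ.trans hS)
      have hev : ∀ᶠ p in 𝓝[Q] y, F ω p < F ω y + ε :=
        hc.eventually (gt_mem_nhds (by linarith))
      have : (𝓝[Q] y).NeBot := mem_closure_iff_nhdsWithin_neBot.1 (hcl hy)
      obtain ⟨p, hp, hpQ⟩ := (hev.and self_mem_nhdsWithin).exists
      exact ⟨p, hpQ, hp⟩
    constructor
    · intro hzC q hq k
      obtain ⟨p, hp, hlt⟩ := happrox (X ∩ C) D' Set.inter_subset_left hDX' hD' (z ω) ⟨hz ω, hzC⟩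
        (1 / ((k : ℝ) + 1)) (by positivity)
      have := hgrow ω q (hDX hq)
      have h0 : 0 ≤ 1 / 2 * ‖q - z ω‖ ^ 2 := by positivity
      exact ⟨p, hp, by linarith⟩
    · intro h
      rw [← hC.closure_eq, Metric.mem_closure_iff]
      intro ε hε
      -- Two errors of `ε ^ 2 / 4` put the value at `p` within `ε ^ 2 / 2` of the minimum, hence `p`
      -- within `ε` of `z ω`.
      obtain ⟨q, hq, hlt⟩ := happrox X D le_rfl hDX hD (z ω) (hz ω) (ε ^ 2 / 4) (by positivity)
      obtain ⟨k, hk⟩ := exists_nat_one_div_lt (show 0 < ε ^ 2 / 4 by positivity)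
      obtain ⟨p, hp, hle⟩ := h q hq k
      refine ⟨p, (hDX' hp).2, ?_⟩
      have := hgrow ω p (hDX' hp).1
      rw [dist_comm, dist_eq_norm]
      exact lt_of_pow_lt_pow_left₀ 2 hε.le (by linarith)
  rw [hset]
  refine MeasurableSet.biInter hDc fun q hq => MeasurableSet.iInter fun k =>
    MeasurableSet.biUnion hDc' fun p hp => ?_
  exact measurableSet_le (hF p (hDX' hp).1) ((hF q (hDX hq)).add_const _)

/-- The Bregman divergence is measurable in its second argument. -/
theorem measurable_bregman_right [NormedSpace ℝ E] [MeasurableSpace E] [BorelSpace E]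
    [SecondCountableTopology E] {X : Set E} {ψ : E → ℝ} (hX : Convex ℝ X)
    (hψ : DifferentiableOn ℝ ψ X) {q : E} (hq : q ∈ X) {v : Ω → E} (hv : Measurable v)
    (hvX : ∀ ω, v ω ∈ X) : Measurable fun ω => bregman X ψ q (v ω) := by
  have hc := hψ.continuousOn
  have h1 : Measurable fun ω => ψ (v ω) :=
    (hc.comp_stronglyMeasurable_of_mem hv.stronglyMeasurable hvX).measurable
  have h2 : Measurable fun ω => fderivWithin ℝ ψ X (v ω) (q - v ω) := by
    -- The derivative itself need not depend measurably on the point, but its value in a feasible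
    -- direction is a limit of difference quotients of `ψ`.
    refine measurable_of_tendsto_metrizable (f := fun (k : ℕ) ω =>
      ((k : ℝ) + 1) * (ψ (v ω + ((k : ℝ) + 1)⁻¹ • (q - v ω)) - ψ (v ω))) (fun k => ?_)
      (tendsto_pi_nhds.2 fun ω => tendsto_fderivWithin_apply_sub hX hψ (hvX ω) hq)
    refine measurable_const.mul (Measurable.sub ?_ h1)
    have hm : Measurable fun ω => v ω + ((k : ℝ) + 1)⁻¹ • (q - v ω) :=
      hv.add ((measurable_const.sub hv).const_smul _)
    exact (hc.comp_stronglyMeasurable_of_mem hm.stronglyMeasurable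
      fun ω => add_inv_succ_smul_sub_mem hX (hvX ω) hq k).measurable
  exact (measurable_const.sub h1).sub h2

/-- The iterates are given only as minimizers, so their measurability has to be derived; strong
convexity supplies the quadratic growth that makes the minimizer a measurable function of the data.
-/
theorem IsProx.measurable [NormedSpace ℝ E] [MeasurableSpace E] [BorelSpace E]
    [SecondCountableTopology E] {X : Set E} {ψ : E → ℝ} (hX : Convex ℝ X) (hψ : IsRegularizer X ψ)
    {v z : Ω → E} {y : Ω → StrongDual ℝ E} (hv : Measurable v) (hvX : ∀ ω, v ω ∈ X)
    (hy : StronglyMeasurable y) (hz : ∀ ω, IsProx X ψ (v ω) (y ω) (z ω)) : Measurable z := by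
  refine measurable_of_quadratic_growth
    (fun ω q => y ω (v ω - q) + bregman X ψ q (v ω)) (fun q hq => ?_) (fun ω => ?_) z
    (fun ω => (hz ω).1) (fun ω q hq => (hz ω).growth hX hψ hq)
  · refine Measurable.add ?_ (measurable_bregman_right hX hψ.differentiableOn hq hv hvX)
    exact (isBoundedBilinearMap_apply.continuous.comp_stronglyMeasurable
      (hy.prodMk (hv.sub_const q).stronglyMeasurable)).measurable
  · unfold bregman
    have := hψ.differentiableOn.continuousOn
    fun_prop

end Measurability

/-! ### Expected disagreement within a network -/

section Disagreement

variable {n : ℕ}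

/-- The bound on the expected distance of a state at time `t` to the mean of its network, if the
expected dual norm of the sampled subgradients is at most `c`. -/
def disagreementBound (n : ℕ) (Γ θ Λ c : ℝ) (α : ℕ → ℝ) (t : ℕ) : ℝ :=
  n * Γ * θ ^ (t - 1) * Λ + n * Γ * c * ∑ s ∈ Finset.Icc 1 (t - 1), θ ^ (t - 1 - s) * α (s - 1) +
    2 * c * α (t - 1)

theorem disagreementBound_nonneg {Γ θ Λ c : ℝ} {α : ℕ → ℝ} (hΓ : 0 ≤ Γ) (hθ : 0 ≤ θ) (hΛ : 0 ≤ Λ)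
    (hc : 0 ≤ c) (hα : ∀ t, 0 ≤ α t) (t : ℕ) : 0 ≤ disagreementBound n Γ θ Λ c α t := by
  have h : 0 ≤ ∑ s ∈ Finset.Icc 1 (t - 1), θ ^ (t - 1 - s) * α (s - 1) :=
    Finset.sum_nonneg fun s _ => mul_nonneg (pow_nonneg hθ _) (hα _)
  have := hα (t - 1)
  unfold disagreementBound
  positivity

theorem sum_Icc_one_eq_sum_range {M : Type*} [AddCommMonoid M] (F : ℕ → M) (m : ℕ) :
    ∑ s ∈ Finset.Icc 1 m, F s = ∑ s ∈ Finset.range m, F (s + 1) := by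
  induction m with
  | zero => simp
  | succ m ih => rw [Finset.sum_Icc_succ_top (by omega), Finset.sum_range_succ, ih]

theorem sum_abs_transition_le_disagreementBound {W : ℕ → Matrix (Fin n) (Fin n) ℝ} {Γ θ Λ c : ℝ}
    {α : ℕ → ℝ} (hΓ : 0 ≤ Γ) (hθ0 : 0 ≤ θ) (hθ1 : θ ≤ 1) (hc : 0 ≤ c) (hα : ∀ t, 0 ≤ α t)
    (hW : ∀ s m i j, |transition W s m i j - 1 / n| ≤ Γ * θ ^ m) {b : Fin n → ℝ}
    (hb0 : ∀ j, 0 ≤ b j) (hb : ∀ j, b j ≤ Λ) {t : ℕ} (ht : 1 ≤ t) (i : Fin n) :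
    ∑ j, |transition W 0 t i j - 1 / n| * b j +
      ∑ s ∈ Finset.range t, ∑ j, |transition W (s + 1) (t - 1 - s) i j - 1 / n| * (α s * c) ≤
    disagreementBound n Γ θ Λ c α t := by
  obtain ⟨t, rfl⟩ := Nat.exists_eq_add_of_le' ht
  -- With the time written as `t + 1`, one power of `θ` is given up so that the exponents match
  -- `disagreementBound`.
  have hpow : ∀ m, θ ^ (m + 1) ≤ θ ^ m := fun m => pow_le_pow_of_le_one hθ0 hθ1 (Nat.le_succ m)
  have hsum : ∀ s m (w : ℝ), 0 ≤ w →
      ∑ j, |transition W s (m + 1) i j - 1 / n| * w ≤ n * Γ * θ ^ m * w := by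
    intro s m w hw
    calc ∑ j, |transition W s (m + 1) i j - 1 / n| * w ≤ ∑ _j : Fin n, Γ * θ ^ m * w := by
          refine Finset.sum_le_sum fun j _ => mul_le_mul_of_nonneg_right ?_ hw
          exact (hW s (m + 1) i j).trans (mul_le_mul_of_nonneg_left (hpow m) hΓ)
      _ = n * Γ * θ ^ m * w := by simp; ring
  have h1 : ∑ j, |transition W 0 (t + 1) i j - 1 / n| * b j ≤ n * Γ * θ ^ t * Λ :=
    (Finset.sum_le_sum fun j _ => mul_le_mul_of_nonneg_left (hb j) (abs_nonneg _)).trans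
      (hsum 0 t Λ ((hb0 i).trans (hb i)))
  -- The newest perturbation carries the identity matrix, and the absolute row sum of `I - 1 / n` is
  -- at most `2` regardless of the mixing rate.
  have h2 : ∑ j, |transition W (t + 1) (t + 1 - 1 - t) i j - 1 / n| * (α t * c) ≤
      2 * c * α t := by
    have hn : (0 : ℝ) < n := by exact_mod_cast i.pos
    have hone : ∑ j, |transition W (t + 1) (t + 1 - 1 - t) i j - 1 / n| ≤ 2 := by
      calc ∑ j, |transition W (t + 1) (t + 1 - 1 - t) i j - 1 / n|
          ≤ ∑ j, ((if i = j then 1 else 0) + 1 / (n : ℝ)) := by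
            refine Finset.sum_le_sum fun j _ => ?_
            have h0 : t + 1 - 1 - t = 0 := by omega
            rw [h0]
            simp only [transition, Matrix.one_apply]
            have : (0 : ℝ) < 1 / n := by positivity
            rw [abs_le]
            split_ifs <;> constructor <;> linarith
        _ = 2 := by
            rw [Finset.sum_add_distrib]
            simp [hn.ne']
            norm_num
    rw [← Finset.sum_mul]
    have := mul_le_mul_of_nonneg_right hone (mul_nonneg (hα t) hc)
    linarith
  have h3 : ∑ s ∈ Finset.range t, ∑ j,
      |transition W (s + 1) (t + 1 - 1 - s) i j - 1 / n| * (α s * c) ≤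
      n * Γ * c * ∑ s ∈ Finset.Icc 1 t, θ ^ (t - s) * α (s - 1) := by
    rw [sum_Icc_one_eq_sum_range, Finset.mul_sum]
    refine Finset.sum_le_sum fun s hs => ?_
    rw [Finset.mem_range] at hs
    have e : t + 1 - 1 - s = (t - (s + 1)) + 1 := by omega
    rw [e]
    refine (hsum _ _ _ (mul_nonneg (hα s) hc)).trans_eq ?_
    rw [Nat.add_sub_cancel]
    ring
  rw [Finset.sum_range_succ]
  unfold disagreementBound
  rw [Nat.add_sub_cancel] at *
  linarith

/-- Expected distance of the states to their mean. -/
theorem integral_norm_sub_mean_le {E : Type*} [NormedAddCommGroup E] [NormedSpace ℝ E]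
    {F : Type*} [NormedAddCommGroup F] {Ω : Type*} [MeasurableSpace Ω] {P : Measure Ω}
    [IsProbabilityMeasure P] {W : ℕ → Matrix (Fin n) (Fin n) ℝ}
    (hcol : ∀ t j, ∑ i, W t i j = 1) {Γ θ Λ c : ℝ}
    {α : ℕ → ℝ} (hΓ : 0 ≤ Γ) (hθ0 : 0 ≤ θ) (hθ1 : θ ≤ 1) (hα : ∀ t, 0 ≤ α t)
    (hc : 0 ≤ c) (hW : ∀ s m i j, |transition W s m i j - 1 / n| ≤ Γ * θ ^ m)
    {x : Fin n → ℕ → Ω → E} (hx : ∀ i t, Integrable (x i t) P) {g : Fin n → ℕ → Ω → F}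
    (hg : ∀ i t, Integrable (g i t) P) (hgc : ∀ i t, ∫ ω, ‖g i t ω‖ ∂P ≤ c)
    (hstep : ∀ i t ω, ‖x i (t + 1) ω - ∑ j, W t i j • x j t ω‖ ≤ α t * ‖g i t ω‖)
    {x₀ : Fin n → E} (hinit : ∀ i ω, x i 0 ω = x₀ i) (hΛ : ∀ i, ‖x₀ i‖ ≤ Λ) {t : ℕ} (ht : 1 ≤ t)
    (i : Fin n) :
    ∫ ω, ‖x i t ω - (1 / (n : ℝ)) • ∑ j, x j t ω‖ ∂P ≤ disagreementBound n Γ θ Λ c α t := by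
  refine le_trans ?_ (sum_abs_transition_le_disagreementBound hΓ hθ0 hθ1 hc hα hW
    (fun j => norm_nonneg (x₀ j)) hΛ ht i)
  have hterm : ∀ s j, Integrable
      (fun ω => |transition W (s + 1) (t - 1 - s) i j - 1 / n| * (α s * ‖g j s ω‖)) P :=
    fun s j => ((hg j s).norm.const_mul _).const_mul _
  have hint : Integrable (fun ω => ∑ s ∈ Finset.range t, ∑ j,
      |transition W (s + 1) (t - 1 - s) i j - 1 / n| * (α s * ‖g j s ω‖)) P :=
    integrable_finsetSum _ fun s _ => integrable_finsetSum _ fun j _ => hterm s j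
  calc ∫ ω, ‖x i t ω - (1 / (n : ℝ)) • ∑ j, x j t ω‖ ∂P
      ≤ ∫ ω, (∑ j, |transition W 0 t i j - 1 / n| * ‖x₀ j‖ + ∑ s ∈ Finset.range t, ∑ j,
          |transition W (s + 1) (t - 1 - s) i j - 1 / n| * (α s * ‖g j s ω‖)) ∂P := by
        refine integral_mono ?_ ((integrable_const _).add hint) fun ω => ?_
        · exact ((hx i t).sub ((integrable_finsetSum _ fun j _ => hx j t).smul _)).norm
        · have := norm_sub_mean_le W hcol (fun t i => x i t ω)
            (fun t i => x i (t + 1) ω - ∑ j, W t i j • x j t ω) (fun t i => by abel) t i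
          refine this.trans (add_le_add (le_of_eq ?_) ?_)
          · simp only [hinit]
          · exact Finset.sum_le_sum fun s _ => Finset.sum_le_sum fun j _ =>
              mul_le_mul_of_nonneg_left (hstep j s ω) (abs_nonneg _)
    _ = ∑ j, |transition W 0 t i j - 1 / n| * ‖x₀ j‖ + ∑ s ∈ Finset.range t, ∑ j,
          |transition W (s + 1) (t - 1 - s) i j - 1 / n| * (α s * ∫ ω, ‖g j s ω‖ ∂P) := by
        rw [integral_add (integrable_const _) hint, integral_const, probReal_univ, one_smul,
          integral_finsetSum _ fun s _ => integrable_finsetSum _ fun j _ => hterm s j]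
        congr 1
        refine Finset.sum_congr rfl fun s _ => ?_
        rw [integral_finsetSum _ fun j _ => hterm s j]
        simp only [integral_const_mul]
    _ ≤ _ := by
        refine add_le_add le_rfl (Finset.sum_le_sum fun s _ => Finset.sum_le_sum fun j _ => ?_)
        exact mul_le_mul_of_nonneg_left (mul_le_mul_of_nonneg_left (hgc j s) (hα s)) (abs_nonneg _)

end Disagreement

/-! ### Integrability and moments -/

section Moments

variable {Ω : Type*} {mΩ : MeasurableSpace Ω} {P : Measure Ω}

theorem ContinuousOn.integrable_comp_of_mem [IsFiniteMeasure P] {F : Type*} [TopologicalSpace F]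
    [TopologicalSpace.PseudoMetrizableSpace F] [MeasurableSpace F] [BorelSpace F]
    [SecondCountableTopology F] {K : Set F} (hK : IsCompact K) {β : Type*} [NormedAddCommGroup β]
    {h : F → β} (hh : ContinuousOn h K) {v : Ω → F} (hv : Measurable v) (hvK : ∀ ω, v ω ∈ K) :
    Integrable (fun ω => h (v ω)) P := by
  obtain ⟨C, hC⟩ := hK.exists_bound_of_continuousOn hh
  exact Integrable.of_bound
    (hh.comp_stronglyMeasurable_of_mem hv.stronglyMeasurable hvK).aestronglyMeasurable C
    (Eventually.of_forall fun ω => hC _ (hvK ω))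

/-- First and second moments of a perturbation with variance at most `ν ^ 2` of a vector bounded
by `L`. -/
theorem moments_of_bounded_variance [IsProbabilityMeasure P] {F : Type*} [NormedAddCommGroup F]
    {g ghat : Ω → F} {L ν : ℝ}
    (hL : 0 ≤ L) (hν : 0 < ν) (hg : ∀ ω, ‖g ω‖ ≤ L) (hgm : AEStronglyMeasurable g P)
    (hghat : Integrable ghat P) (hsq : Integrable (fun ω => ‖g ω - ghat ω‖ ^ 2) P)
    (hvar : ∫ ω, ‖g ω - ghat ω‖ ^ 2 ∂P ≤ ν ^ 2) :
    ∫ ω, ‖ghat ω‖ ∂P ≤ L + ν ∧ Integrable (fun ω => ‖ghat ω‖ ^ 2) P ∧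
      ∫ ω, ‖ghat ω‖ ^ 2 ∂P ≤ (L + ν) ^ 2 := by
  have hgi : Integrable g P := Integrable.of_bound hgm L (Eventually.of_forall hg)
  have hN : Integrable (fun ω => ‖g ω - ghat ω‖) P := (hgi.sub hghat).norm
  have hN1 : ∫ ω, ‖g ω - ghat ω‖ ∂P ≤ ν := by
    -- The pointwise bound `N ≤ N ^ 2 / (2 ν) + ν / 2` passes from the second moment to the first.
    calc ∫ ω, ‖g ω - ghat ω‖ ∂P ≤ ∫ ω, (1 / (2 * ν) * ‖g ω - ghat ω‖ ^ 2 + ν / 2) ∂P := by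
          refine integral_mono hN ((hsq.const_mul _).add (integrable_const _)) fun ω => ?_
          have : 1 / (2 * ν) * ‖g ω - ghat ω‖ ^ 2 + ν / 2 - ‖g ω - ghat ω‖ =
              1 / (2 * ν) * (‖g ω - ghat ω‖ - ν) ^ 2 := by field_simp; ring
          have h0 : 0 ≤ 1 / (2 * ν) * (‖g ω - ghat ω‖ - ν) ^ 2 := by positivity
          dsimp only
          linarith
      _ = 1 / (2 * ν) * ∫ ω, ‖g ω - ghat ω‖ ^ 2 ∂P + ν / 2 := by
          rw [integral_add (hsq.const_mul _) (integrable_const _), integral_const_mul,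
            integral_const, probReal_univ, one_smul]
      _ ≤ 1 / (2 * ν) * ν ^ 2 + ν / 2 := by gcongr
      _ = ν := by field_simp; ring
  have hle : ∀ ω, ‖ghat ω‖ ≤ L + ‖g ω - ghat ω‖ := fun ω => by
    have := norm_sub_norm_le (ghat ω) (g ω)
    rw [norm_sub_rev] at this
    linarith [hg ω]
  have hle2 : ∀ ω, ‖ghat ω‖ ^ 2 ≤
      L ^ 2 + 2 * L * ‖g ω - ghat ω‖ + ‖g ω - ghat ω‖ ^ 2 := fun ω => by
    refine (pow_le_pow_left₀ (norm_nonneg _) (hle ω) 2).trans_eq (by ring)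
  have hlin : Integrable (fun ω => L ^ 2 + 2 * L * ‖g ω - ghat ω‖) P :=
    (integrable_const _).add (hN.const_mul _)
  have hdom : Integrable (fun ω => L ^ 2 + 2 * L * ‖g ω - ghat ω‖ + ‖g ω - ghat ω‖ ^ 2) P :=
    hlin.add hsq
  have hsq' : Integrable (fun ω => ‖ghat ω‖ ^ 2) P := by
    refine hdom.mono' (hghat.aestronglyMeasurable.norm.pow 2) (Eventually.of_forall fun ω => ?_)
    rw [Real.norm_of_nonneg (by positivity)]
    exact hle2 ω
  refine ⟨?_, hsq', ?_⟩
  · calc ∫ ω, ‖ghat ω‖ ∂P ≤ ∫ ω, (L + ‖g ω - ghat ω‖) ∂P :=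
          integral_mono hghat.norm ((integrable_const _).add hN) hle
      _ = L + ∫ ω, ‖g ω - ghat ω‖ ∂P := by
          rw [integral_add (integrable_const _) hN, integral_const, probReal_univ, one_smul]
      _ ≤ L + ν := by linarith
  · calc ∫ ω, ‖ghat ω‖ ^ 2 ∂P
        ≤ ∫ ω, (L ^ 2 + 2 * L * ‖g ω - ghat ω‖ + ‖g ω - ghat ω‖ ^ 2) ∂P :=
          integral_mono hsq' hdom hle2
      _ = L ^ 2 + 2 * L * ∫ ω, ‖g ω - ghat ω‖ ∂P + ∫ ω, ‖g ω - ghat ω‖ ^ 2 ∂P := by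
          rw [integral_add hlin hsq,
            integral_add (integrable_const _) (hN.const_mul _), integral_const_mul,
            integral_const, probReal_univ, one_smul]
      _ ≤ (L + ν) ^ 2 := by nlinarith

theorem integrable_apply_of_bound {E : Type*} [NormedAddCommGroup E] [NormedSpace ℝ E]
    {g : Ω → StrongDual ℝ E} (hg : Integrable g P) {w : Ω → E} (hw : AEStronglyMeasurable w P)
    {C : ℝ} (hC : ∀ ω, ‖w ω‖ ≤ C) : Integrable (fun ω => g ω (w ω)) P := by
  refine (hg.norm.mul_const C).mono'
    (isBoundedBilinearMap_apply.continuous.comp_aestronglyMeasurable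
      (hg.aestronglyMeasurable.prodMk hw)) (Eventually.of_forall fun ω => ?_)
  exact ((g ω).le_opNorm _).trans (mul_le_mul_of_nonneg_left (hC ω) (norm_nonneg _))

/-- A conditional expectation may replace a random functional that is evaluated at a vector known
in advance. -/
theorem integral_apply_eq_of_condExp [IsFiniteMeasure P] {E : Type*} [NormedAddCommGroup E]
    [NormedSpace ℝ E]
    {m : MeasurableSpace Ω} (hm : m ≤ mΩ) {ghat g : Ω → StrongDual ℝ E}
    (hghat : Integrable ghat P) (hcond : P[ghat | m] =ᵐ[P] g) {w : Ω → E}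
    (hw : StronglyMeasurable[m] w) {C : ℝ} (hC : ∀ ω, ‖w ω‖ ≤ C) :
    ∫ ω, ghat ω (w ω) ∂P = ∫ ω, g ω (w ω) ∂P := by
  have hint := integrable_apply_of_bound hghat (hw.mono hm).aestronglyMeasurable hC
  have h := condExp_bilin_of_stronglyMeasurable_right
    (ContinuousLinearMap.id ℝ (StrongDual ℝ E)) hw hint hghat
  rw [← integral_condExp hm]
  refine integral_congr_ae ?_
  filter_upwards [h, hcond] with ω h1 h2
  rw [← h2]
  exact h1

end Moments

/-! ### The two-network game -/

section History

variable {E : Fin 2 → Type*} {n : Fin 2 → ℕ} [∀ l, MeasurableSpace (E l)] {Ω : Type*}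
  {d : ℕ} {x : ∀ l, Fin (n l) → ℕ → Ω → E l} {ξs : ∀ l, Fin (n l) → ℕ → Ω → Fin d → ℝ}

theorem history_mono : Monotone (history x ξs) := fun s t hst => by
  refine sup_le_sup le_rfl ?_
  refine iSup_mono fun l => iSup_mono fun i => iSup_mono fun r => ?_
  exact iSup_le fun hr => le_iSup_of_le (hr.trans_le hst) le_rfl

theorem history_le [mΩ : MeasurableSpace Ω] {x₀ : ∀ l, Fin (n l) → E l}
    (hinit : ∀ l i ω, x l i 0 ω = x₀ l i) (hξs : ∀ l i t, Measurable (ξs l i t)) (t : ℕ) :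
    history x ξs t ≤ mΩ := by
  refine sup_le (iSup_le fun l => iSup_le fun i => ?_)
    (iSup_le fun l => iSup_le fun i => iSup_le fun s => iSup_le fun _ => (hξs l i s).comap_le)
  -- Deterministic initial states generate only the trivial σ-algebra.
  rw [show x l i 0 = fun _ => x₀ l i from funext (hinit l i)]
  exact measurable_const.comap_le

end History

section Game

variable {E : Fin 2 → Type*} [∀ l, NormedAddCommGroup (E l)] {n : Fin 2 → ℕ}

theorem LipschitzCosts.abs_update_sub_le {O : ∀ l, Set (E l)}
    {f : ∀ l, Fin (n l) → (∀ k, E k) → ℝ} {L : ℝ} (h : LipschitzCosts O f L) (l : Fin 2)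
    (i : Fin (n l)) {z : ∀ k, E k} (hz : ∀ k, z k ∈ O k) (k : Fin 2) {y : E k} (hy : y ∈ O k) :
    |f l i (Function.update z k y) - f l i z| ≤ L * ‖y - z k‖ := by
  have hmem : ∀ k', Function.update z k y k' ∈ O k' := fun k' => by
    by_cases hk : k' = k
    · subst hk; simpa using hy
    · simpa [hk] using hz k'
  have := h l i _ z hmem hz
  fin_cases k
  · simpa using this
  · simpa using this

theorem LipschitzCosts.continuousOn {O : ∀ l, Set (E l)}
    {f : ∀ l, Fin (n l) → (∀ k, E k) → ℝ} {L : ℝ} (hL : 0 ≤ L) (h : LipschitzCosts O f L)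
    (l : Fin 2) (i : Fin (n l)) : ContinuousOn (f l i) (Set.univ.pi O) := by
  refine (LipschitzOnWith.of_dist_le_mul (K := (2 * L).toNNReal) fun z hz z' hz' => ?_).continuousOn
  rw [Real.dist_eq, Real.coe_toNNReal _ (by positivity), dist_eq_norm]
  refine (h l i z z' (fun k => hz k trivial) (fun k => hz' k trivial)).trans ?_
  have h0 := norm_le_pi_norm (z - z') 0
  have h1 := norm_le_pi_norm (z - z') 1
  simp only [Pi.sub_apply] at h0 h1
  nlinarith

variable [∀ l, NormedSpace ℝ (E l)]

/-- As `z l` is interior to `O l`, the subgradient inequality can be tested at `z l ± w` for all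
small `w`, where the Lipschitz bound limits the increase to `L * ‖w‖`. -/
theorem norm_le_of_mem_partialSubdiff {O : ∀ l, Set (E l)} (hO : ∀ l, IsOpen (O l))
    {f : ∀ l, Fin (n l) → (∀ k, E k) → ℝ} {L : ℝ} (hL : 0 ≤ L) (h : LipschitzCosts O f L)
    (l : Fin 2) (i : Fin (n l)) {z : ∀ k, E k} (hz : ∀ k, z k ∈ O k) {g : StrongDual ℝ (E l)}
    (hg : g ∈ partialSubdiff O l (f l i) z) : ‖g‖ ≤ L := by
  obtain ⟨ε, hε, hball⟩ := Metric.isOpen_iff.1 (hO l) (z l) (hz l)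
  have key : ∀ w : E l, ‖w‖ < ε → g w ≤ L * ‖w‖ := by
    intro w hw
    have hmem : z l + w ∈ O l := hball (by simpa using hw)
    have h1 := hg _ hmem
    have h2 := (le_abs_self _).trans (h.abs_update_sub_le l i hz l hmem)
    rw [add_sub_cancel_left] at h1 h2
    linarith
  refine ContinuousLinearMap.opNorm_le_of_ball hε hL fun w hw => ?_
  rw [mem_ball_zero_iff] at hw
  rw [Real.norm_eq_abs, abs_le]
  have h1 := key w hw
  have h2 := key (-w) (by rwa [norm_neg])
  rw [norm_neg, map_neg] at h2
  constructor <;> linarith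

/-- Linearization of the cost of the game at the averages formed by the agents. -/
theorem gameCost_sub_le {O : ∀ l, Set (E l)} {f : ∀ l, Fin (n l) → (∀ k, E k) → ℝ} {L : ℝ}
    (h : LipschitzCosts O f L) {z : Fin (n 0) → ∀ k, E k}
    (hz : ∀ j k, z j k ∈ O k) {g : Fin (n 0) → StrongDual ℝ (E 0)}
    (hg : ∀ j, g j ∈ partialSubdiff O 0 (f 0 j) (z j)) (i : Fin (n 0)) {p q : E 0} (hp : p ∈ O 0)
    (hq : q ∈ O 0) :
    gameCost f (Function.update (z i) 0 p) - gameCost f (Function.update (z i) 0 q) ≤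
      1 / (n 0 : ℝ) * ∑ j, (g j (z j 0 - q) +
        L * (‖p - z j 0‖ + 2 * ‖z i 1 - z j 1‖)) := by
  unfold gameCost
  rw [← mul_sub, ← Finset.sum_sub_distrib]
  refine mul_le_mul_of_nonneg_left (Finset.sum_le_sum fun j _ => ?_) (by positivity)
  have hmem : ∀ j' (y : E 0), y ∈ O 0 → ∀ k, Function.update (z j') 0 y k ∈ O k := by
    intro j' y hy k
    fin_cases k
    · simpa using hy
    · simpa using hz j' 1
  -- For each `j` the path runs from `(p, u i)` to the agent's own point `(v j, u j)`, then to `(q,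
  -- u j)` by the subgradient inequality, then to `(q, u i)`. The second coordinate changes twice,
  -- whence the factor `2`.
  have h1 := (le_abs_self _).trans (h 0 j _ _ (hmem i p hp) (hz j))
  have h2 := (le_abs_self _).trans (h 0 j _ _ (hmem j q hq) (hmem i q hq))
  have h3 := hg j q hq
  have h4 : g j (z j 0 - q) = -g j (q - z j 0) := by rw [← map_neg, neg_sub]
  simp only [Function.update_self, ne_eq, one_ne_zero, not_false_eq_true, Function.update_of_ne,
    sub_self, norm_zero, zero_add] at h1 h2
  rw [norm_sub_rev (z j 1)] at h2
  rw [h4]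
  linarith

theorem mixing_nonneg_row_sum {η : ℝ} (hη : 0 < η) {B : Fin 2 → ℕ}
    {G : ∀ l, ℕ → Digraph (Fin (n l))} {G12 : ℕ → Digraph (Σ l, Fin (n l))}
    {W : ∀ l k : Fin 2, ℕ → Matrix (Fin (n l)) (Fin (n k)) ℝ}
    (hW : ∀ l, IsNetworkMixing η (B l) (G l) (W l l)) (hW12 : IsCrossMixing G12 W) (l k : Fin 2)
    (t : ℕ) (i : Fin (n l)) : (∀ j, 0 ≤ W l k t i j) ∧ ∑ j, W l k t i j = 1 := by
  by_cases h : l = k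
  · subst h
    exact ⟨((hW l).isUniformMixing hη).nonneg t i, (hW l).row_sum t i⟩
  · exact ⟨hW12.nonneg l k h t i, hW12.row_sum l k h t i⟩

theorem norm_sum_smul_sub_le {ι F : Type*} [Fintype ι] [NormedAddCommGroup F] [NormedSpace ℝ F]
    {w : ι → ℝ} (hw : ∀ j, 0 ≤ w j) (hw1 : ∑ j, w j = 1) (x : ι → F) (c : F) :
    ‖∑ j, w j • x j - c‖ ≤ ∑ j, w j * ‖x j - c‖ := by
  have e : ∑ j, w j • x j - c = ∑ j, w j • (x j - c) := by
    simp only [smul_sub, Finset.sum_sub_distrib, ← Finset.sum_smul, hw1, one_smul]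
  rw [e]
  refine (norm_sum_le _ _).trans_eq ?_
  simp only [norm_smul, Real.norm_of_nonneg (hw _)]

variable [∀ l, MeasurableSpace (E l)] {Ω : Type*} {d : ℕ}
  {x : ∀ l, Fin (n l) → ℕ → Ω → E l} {ξs : ∀ l, Fin (n l) → ℕ → Ω → Fin d → ℝ}

variable {X O : ∀ l, Set (E l)} {ψ : ∀ l, E l → ℝ}
  {Ψ : ∀ l, Fin (n l) → (∀ k, E k) → (Fin d → ℝ) → ℝ}
  {W : ∀ l k : Fin 2, ℕ → Matrix (Fin (n l)) (Fin (n k)) ℝ} {α : ℕ → ℝ}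
  {x₀ : ∀ l, Fin (n l) → E l} {ghat : ∀ l, Fin (n l) → ℕ → Ω → StrongDual ℝ (E l)}

theorem IsDSMD.state_mem (h : IsDSMD X O ψ Ψ W α ξs x₀ x ghat) (l : Fin 2) (i : Fin (n l))
    (t : ℕ) (ω : Ω) : x l i t ω ∈ X l := by
  cases t with
  | zero => rw [h.init]; exact h.init_mem l i
  | succ t => exact (h.update l i t ω).1

theorem IsDSMD.averages_mem (h : IsDSMD X O ψ Ψ W α ξs x₀ x ghat) (hX : ∀ l, Convex ℝ (X l))
    (hW : ∀ l k t i, (∀ j, 0 ≤ W l k t i j) ∧ ∑ j, W l k t i j = 1) (l : Fin 2) (i : Fin (n l))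
    (t : ℕ) (ω : Ω) (k : Fin 2) : averages W x l i t ω k ∈ X k :=
  (hX k).sum_mem (fun j _ => (hW l k t i).1 j) (hW l k t i).2 fun j _ => h.state_mem k j t ω

theorem averages_measurable [∀ l, BorelSpace (E l)] [∀ l, SecondCountableTopology (E l)]
    {m : MeasurableSpace Ω} {t : ℕ} (hx : ∀ l i, Measurable (x l i t)) (l : Fin 2) (i : Fin (n l))
    (k : Fin 2) : Measurable fun ω => averages W x l i t ω k := by
  unfold averages
  exact Finset.measurable_sum _ fun j _ => (hx k j).const_smul _

/-- The states at time `t` are determined measurably by the samples before time `t`. -/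
theorem IsDSMD.state_measurable [∀ l, BorelSpace (E l)] [∀ l, SecondCountableTopology (E l)]
    (h : IsDSMD X O ψ Ψ W α ξs x₀ x ghat) (hX : ∀ l, Convex ℝ (X l))
    (hψ : ∀ l, IsRegularizer (X l) (ψ l))
    (hW : ∀ l k t i, (∀ j, 0 ≤ W l k t i j) ∧ ∑ j, W l k t i j = 1) (t : ℕ) (l : Fin 2)
    (i : Fin (n l)) : Measurable[history x ξs t] (x l i t) := by
  induction t generalizing l i with
  | zero =>
    refine Measurable.mono (comap_measurable (x l i 0)) ?_ le_rfl
    exact le_sup_of_le_left (le_iSup_of_le l (le_iSup_of_le i le_rfl))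
  | succ t ih =>
    have hx : ∀ l i, Measurable[history x ξs (t + 1)] (x l i t) := fun l i =>
      (ih l i).mono (history_mono (Nat.le_succ t)) le_rfl
    exact IsProx.measurable (m := history x ξs (t + 1)) (hX l) (hψ l)
      (averages_measurable (m := history x ξs (t + 1)) hx l i l)
      (fun ω => h.averages_mem hX hW l i t ω l)
      ((h.sample_measurable l i t).const_smul (α t)).neg (h.update l i t)

theorem IsDSMD.norm_state_sub_le (h : IsDSMD X O ψ Ψ W α ξs x₀ x ghat)
    (hX : ∀ l, Convex ℝ (X l)) (hψ : ∀ l, IsRegularizer (X l) (ψ l)) (hα : ∀ t, 0 ≤ α t)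
    (hW : ∀ l k t i, (∀ j, 0 ≤ W l k t i j) ∧ ∑ j, W l k t i j = 1) (l : Fin 2) (i : Fin (n l))
    (t : ℕ) (ω : Ω) : ‖x l i (t + 1) ω - ∑ j, W l l t i j • x l j t ω‖ ≤ α t * ‖ghat l i t ω‖ := by
  have := (h.update l i t ω).norm_sub_le (hX l) (hψ l) (h.averages_mem hX hW l i t ω l)
  rwa [norm_neg, norm_smul, Real.norm_of_nonneg (hα t)] at this

end Game

/-! ### Expected distances through the network means -/

theorem integral_norm_sub_le_add {Ω : Type*} [MeasurableSpace Ω] {P : Measure Ω} {F : Type*}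
    [NormedAddCommGroup F] {a b c : Ω → F} (ha : Integrable a P) (hb : Integrable b P)
    (hc : Integrable c P) :
    ∫ ω, ‖a ω - b ω‖ ∂P ≤ ∫ ω, ‖a ω - c ω‖ ∂P + ∫ ω, ‖b ω - c ω‖ ∂P := by
  have hac : Integrable (fun ω => ‖a ω - c ω‖) P := (ha.sub hc).norm
  have hbc : Integrable (fun ω => ‖b ω - c ω‖) P := (hb.sub hc).norm
  rw [← integral_add hac hbc]
  refine integral_mono (ha.sub hb).norm (hac.add hbc) fun ω => ?_
  dsimp only
  rw [norm_sub_rev (b ω)]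
  exact norm_sub_le_norm_sub_add_norm_sub _ _ _

/-- Convexity of the norm. Only convex weights are needed, so it serves the averages within a
network and those received from the other one alike. -/
theorem integral_norm_sum_smul_sub_le {Ω : Type*} [MeasurableSpace Ω] {P : Measure Ω}
    {ι F : Type*} [Fintype ι] [NormedAddCommGroup F] [NormedSpace ℝ F] {w : ι → ℝ}
    (hw : ∀ j, 0 ≤ w j) (hw1 : ∑ j, w j = 1) {x : ι → Ω → F} (hx : ∀ j, Integrable (x j) P)
    {c : Ω → F} (hc : Integrable c P) {H : ℝ} (hH : ∀ j, ∫ ω, ‖x j ω - c ω‖ ∂P ≤ H) :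
    ∫ ω, ‖∑ j, w j • x j ω - c ω‖ ∂P ≤ H := by
  have hterm : ∀ j, Integrable (fun ω => w j * ‖x j ω - c ω‖) P := fun j =>
    ((hx j).sub hc).norm.const_mul _
  calc ∫ ω, ‖∑ j, w j • x j ω - c ω‖ ∂P ≤ ∫ ω, ∑ j, w j * ‖x j ω - c ω‖ ∂P := by
        refine integral_mono ?_ (integrable_finsetSum _ fun j _ => hterm j) fun ω =>
          norm_sum_smul_sub_le hw hw1 _ _
        exact ((integrable_finsetSum _ fun j _ => (hx j).smul (w j)).sub hc).norm
    _ = ∑ j, w j * ∫ ω, ‖x j ω - c ω‖ ∂P := by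
        rw [integral_finsetSum _ fun j _ => hterm j]
        simp only [integral_const_mul]
    _ ≤ ∑ j, w j * H := Finset.sum_le_sum fun j _ => mul_le_mul_of_nonneg_left (hH j) (hw j)
    _ = H := by rw [← Finset.sum_mul, hw1, one_mul]

/-! ### The regret bound -/

theorem theorem2 {E : Fin 2 → Type*} [∀ l, NormedAddCommGroup (E l)] [∀ l, NormedSpace ℝ (E l)]
    [∀ l, FiniteDimensional ℝ (E l)] [∀ l, MeasurableSpace (E l)] [∀ l, BorelSpace (E l)]
    {Ω : Type*} [MeasurableSpace Ω] (P : Measure Ω) [IsProbabilityMeasure P]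
    {d : ℕ} (ξ : Ω → Fin d → ℝ) (n : Fin 2 → ℕ) (hn : ∀ l, 1 ≤ n l)
    (X O : ∀ l, Set (E l)) (ψ : ∀ l, E l → ℝ) (hψ : ∀ l, IsRegularizer (X l) (ψ l))
    (Ψ : ∀ l, Fin (n l) → (∀ k, E k) → (Fin d → ℝ) → ℝ)
    (hΨ : ∀ l i, ∀ z : ∀ k, E k, (∀ k, z k ∈ O k) → Integrable (fun ω => Ψ l i z (ξ ω)) P)
    (f : ∀ l, Fin (n l) → (∀ k, E k) → ℝ) (hf : ∀ l i, f l i = expectedCost P ξ (Ψ l i))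
    (hgame : IsTwoNetworkGame X O f)
    (η : ℝ) (hη0 : 0 < η) (hη1 : η < 1) (B : Fin 2 → ℕ) (hB : ∀ l, 1 ≤ B l)
    (G : ∀ l, ℕ → Digraph (Fin (n l))) (G12 : ℕ → Digraph (Σ l, Fin (n l)))
    (W : ∀ l k : Fin 2, ℕ → Matrix (Fin (n l)) (Fin (n k)) ℝ)
    (hW : ∀ l, IsNetworkMixing η (B l) (G l) (W l l)) (hW12 : IsCrossMixing G12 W)
    (α : ℕ → ℝ) (hα0 : ∀ t, 0 ≤ α t) (hα : Antitone α)
    (ξs : ∀ l, Fin (n l) → ℕ → Ω → Fin d → ℝ) (hξs : IsIIDSample P ξ ξs)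
    (x₀ : ∀ l, Fin (n l) → E l) (x : ∀ l, Fin (n l) → ℕ → Ω → E l)
    (ghat g : ∀ l, Fin (n l) → ℕ → Ω → StrongDual ℝ (E l))
    (hrun : IsDSMD X O ψ Ψ W α ξs x₀ x ghat)
    (hg : ∀ l i t ω, g l i t ω ∈ partialSubdiff O l (f l i) (averages W x l i t ω))
    (L : ℝ) (hL : 0 < L) (ν : Fin 2 → ℝ) (hν : ∀ l, 0 < ν l)
    (hA1 : LipschitzCosts O f L)
    (hA2 : UnbiasedBoundedVariance P (history x ξs) ghat g ν)
    (hA3 : ∀ l, BregmanConvexReciprocal (X l) (ψ l))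
    (R₁ : ℝ)
    (hR₁ : IsGreatest {r | ∃ y ∈ X 0, ∃ y' ∈ X 0, r = bregman (X 0) (ψ 0) y y'} (R₁ ^ 2))
    (Γ θ Λ : Fin 2 → ℝ) (hΓ : ∀ l, Γ l = mixGamma η (n l))
    (hθ : ∀ l, θ l = mixTheta η (n l) (B l)) (hΛ : ∀ l, Λ l = ⨆ i, ‖x₀ l i‖)
    (i : Fin (n 0)) (T : ℕ) (hT : 0 < α T) :
    pseudoRegret P X (gameCost f) (x 0 i) (averages W x 0 i) T ≤
      (∑ t ∈ Finset.Icc 1 T, ∑ l, (L + ν l) * (9 * L + ν l) * α (t - 1))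
      + 4 * L * (∑ t ∈ Finset.Icc 1 T, ∑ l, n l * Γ l * (L + ν l) *
          ∑ s ∈ Finset.Icc 1 (t - 1), θ l ^ (t - 1 - s) * α (s - 1))
      + 4 * L * (∑ t ∈ Finset.Icc 1 T, ∑ l, n l * Γ l * θ l ^ (t - 1) * Λ l)
      + R₁ ^ 2 / α T := by

  have hX := hgame.convex
  have hWs := mixing_nonneg_row_sum hη0 hW hW12
  have hn' : ∀ l, (0 : ℝ) < n l := fun l => by exact_mod_cast hn l
  have hhist := fun t => history_le (x := x) hrun.init hξs.measurable t
  have hxm' := hrun.state_measurable hX hψ hWs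
  have hxm : ∀ l i t, Measurable (x l i t) := fun l i t => (hxm' t l i).mono (hhist t) le_rfl
  have havm : ∀ l i t k, Measurable fun ω => averages W x l i t ω k := fun l i t k =>
    averages_measurable (fun l i => hxm l i t) l i k
  have hxi : ∀ l i t, Integrable (x l i t) P := fun l i t =>
    continuousOn_id.integrable_comp_of_mem (hgame.compact l) (hxm l i t) (hrun.state_mem l i t)
  have havX := hrun.averages_mem hX hWs
  have havi : ∀ l i t k, Integrable (fun ω => averages W x l i t ω k) P := fun l i t k =>
    continuousOn_id.integrable_comp_of_mem (hgame.compact k) (havm l i t k)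
      fun ω => havX l i t ω k
  have hgL : ∀ l i t ω, ‖g l i t ω‖ ≤ L := fun l i t ω =>
    norm_le_of_mem_partialSubdiff hgame.isOpen hL.le hA1 l i
      (fun k => hgame.subset k (havX l i t ω k)) (hg l i t ω)
  -- Measurability of the selected true subgradients is inherited from the conditional expectation
  -- with which they agree almost everywhere.
  have hgm : ∀ l i t, AEStronglyMeasurable (g l i t) P := fun l i t =>
    (stronglyMeasurable_condExp.mono (hhist t)).aestronglyMeasurable.congr (hA2.unbiased l i t)
  have hgi : ∀ l i t, Integrable (g l i t) P := fun l i t =>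
    Integrable.of_bound (hgm l i t) L (Eventually.of_forall (hgL l i t))
  have hmom := fun l i t => moments_of_bounded_variance hL.le (hν l) (hgL l i t) (hgm l i t)
    (hA2.integrable l i t) (hA2.integrable_sq l i t) (by
      rw [← integral_condExp (hhist t)]
      refine (integral_mono_ae integrable_condExp (integrable_const _)
        (hA2.variance_le l i t)).trans_eq ?_
      simp)
  have hΓ0 : ∀ l, 0 ≤ Γ l := fun l => by
    rw [hΓ]; exact (mixGamma_pos hη0 hη1 (hn l)).le
  have hθ0 : ∀ l, 0 ≤ θ l := fun l => by
    rw [hθ]; exact (mixTheta_pos hη0 hη1 (hn l) (B l)).le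
  have hθ1 : ∀ l, θ l ≤ 1 := fun l => by
    rw [hθ]; exact mixTheta_le_one hη0 hη1 (hn l) (B l)
  have hx₀ : ∀ l i, ‖x₀ l i‖ ≤ Λ l := fun l i => by
    rw [hΛ]; exact le_ciSup (Set.finite_range fun i => ‖x₀ l i‖).bddAbove i
  have hΛ0 : ∀ l, 0 ≤ Λ l := fun l => (norm_nonneg _).trans (hx₀ l ⟨0, hn l⟩)
  have hc0 : ∀ l, 0 ≤ L + ν l := fun l => (add_pos hL (hν l)).le
  set H : Fin 2 → ℕ → ℝ := fun l t =>
    disagreementBound (n l) (Γ l) (θ l) (Λ l) (L + ν l) α t with hH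
  have hH0 : ∀ l t, 0 ≤ H l t := fun l t =>
    disagreementBound_nonneg (hΓ0 l) (hθ0 l) (hΛ0 l) (hc0 l) hα0 t
  let c : ∀ l, ℕ → Ω → E l := fun l t ω => (1 / (n l : ℝ)) • ∑ j, x l j t ω
  have hci : ∀ l t, Integrable (c l t) P := fun l t =>
    (integrable_finsetSum _ fun j _ => hxi l j t).smul _
  have hdis : ∀ l i t, 1 ≤ t → ∫ ω, ‖x l i t ω - c l t ω‖ ∂P ≤ H l t := by
    intro l i t ht
    refine integral_norm_sub_mean_le (hW l).col_sum (hΓ0 l) (hθ0 l) (hθ1 l) hα0 (hc0 l) ?_ (hxi l)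
      (hA2.integrable l) (fun i t => (hmom l i t).1)
      (hrun.norm_state_sub_le hX hψ hα0 hWs l) (hrun.init l) (hx₀ l) ht i
    intro s m i j
    rw [hΓ, hθ]
    exact ((hW l).isUniformMixing hη0).abs_transition_sub_le hη0 hη1 (hn l) (hB l) s m i j
  have havg : ∀ l i t k, 1 ≤ t → ∫ ω, ‖averages W x l i t ω k - c k t ω‖ ∂P ≤ H k t :=
    fun l i t k ht => integral_norm_sum_smul_sub_le (hWs l k t i).1 (hWs l k t i).2
      (fun j => hxi k j t) (hci k t) fun j => hdis k j t ht
  have hUc : ContinuousOn (gameCost f) (Set.univ.pi X) := by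
    unfold gameCost
    refine continuousOn_const.mul (continuousOn_finsetSum _ fun j _ => ?_)
    exact (hA1.continuousOn hL.le 0 j).mono (Set.pi_mono fun k _ => hgame.subset k)
  have hUi : ∀ t (p : Ω → E 0), Measurable p → (∀ ω, p ω ∈ X 0) →
      Integrable (fun ω => gameCost f (Function.update (averages W x 0 i t ω) 0 (p ω))) P := by
    intro t p hp hpX
    refine hUc.integrable_comp_of_mem (isCompact_univ_pi hgame.compact)
      (measurable_pi_iff.2 fun k => ?_) fun ω k _ => ?_
    · fin_cases k
      · simpa using hp
      · simpa using havm 0 i t 1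
    · fin_cases k
      · simpa using hpX ω
      · simpa using havX 0 i t ω 1
  have hX0 : (X 0).Nonempty := ⟨_, hrun.init_mem 0 i⟩
  -- Moving the infimum to one side reduces the claim to a bound for each fixed competitor `q`.
  rw [pseudoRegret, sub_le_comm]
  refine le_csInf (hX0.image _) ?_
  rintro _ ⟨q, hq, rfl⟩
  rw [sub_le_comm]
  dsimp only
  rw [integral_finsetSum _ fun t _ => hUi t _ (hxm 0 i t) (hrun.state_mem 0 i t),
    integral_finsetSum _ fun t _ => hUi t _ measurable_const fun _ => hq, ← Finset.sum_sub_distrib]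
  obtain ⟨C, hC⟩ := (hgame.compact 0).exists_bound_of_continuousOn
    (f := fun y => y - q) (by fun_prop)
  have hwm : ∀ j t, Measurable[history x ξs t] fun ω => averages W x 0 j t ω 0 - q := fun j t =>
    (averages_measurable (m := history x ξs t) (hxm' t) 0 j 0).sub_const q
  have hwC : ∀ j t ω, ‖averages W x 0 j t ω 0 - q‖ ≤ C := fun j t ω => hC _ (havX 0 j t ω 0)
  have hgai : ∀ j t, Integrable (fun ω => g 0 j t ω (averages W x 0 j t ω 0 - q)) P := fun j t =>
    integrable_apply_of_bound (hgi 0 j t) ((havi 0 j t 0).sub (integrable_const q)).1 (hwC j t)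
  have hghati : ∀ j t, Integrable (fun ω => ghat 0 j t ω (averages W x 0 j t ω 0 - q)) P :=
    fun j t => integrable_apply_of_bound (hA2.integrable 0 j t)
      ((havi 0 j t 0).sub (integrable_const q)).1 (hwC j t)
  -- Through the means, `x i` to `v j` costs `2 H 0`; `u i` to `u j` costs `2 H 1` and is counted
  -- twice.
  have hstep : ∀ t ∈ Finset.Icc 1 T,
      ∫ ω, gameCost f (Function.update (averages W x 0 i t ω) 0 (x 0 i t ω)) ∂P -
        ∫ ω, gameCost f (Function.update (averages W x 0 i t ω) 0 q) ∂P ≤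
      1 / (n 0 : ℝ) * ∑ j, ∫ ω, ghat 0 j t ω (averages W x 0 j t ω 0 - q) ∂P +
        L * (2 * H 0 t + 4 * H 1 t) := by
    intro t ht
    have ht1 := (Finset.mem_Icc.1 ht).1
    rw [← integral_sub (hUi t _ (hxm 0 i t) (hrun.state_mem 0 i t))
      (hUi t _ measurable_const fun _ => hq)]
    have hi1 : ∀ j, Integrable (fun ω => ‖x 0 i t ω - averages W x 0 j t ω 0‖) P := fun j =>
      ((hxi 0 i t).sub (havi 0 j t 0)).norm
    have hi2 : ∀ j, Integrable
        (fun ω => 2 * ‖averages W x 0 i t ω 1 - averages W x 0 j t ω 1‖) P := fun j =>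
      ((havi 0 i t 1).sub (havi 0 j t 1)).norm.const_mul 2
    have hi3 : ∀ j, Integrable (fun ω => L * (‖x 0 i t ω - averages W x 0 j t ω 0‖ +
        2 * ‖averages W x 0 i t ω 1 - averages W x 0 j t ω 1‖)) P := fun j =>
      ((hi1 j).add (hi2 j)).const_mul L
    have hi4 : ∀ j, Integrable (fun ω => g 0 j t ω (averages W x 0 j t ω 0 - q) +
        L * (‖x 0 i t ω - averages W x 0 j t ω 0‖ +
        2 * ‖averages W x 0 i t ω 1 - averages W x 0 j t ω 1‖)) P := fun j =>
      (hgai j t).add (hi3 j)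
    refine (integral_mono ((hUi t _ (hxm 0 i t) (hrun.state_mem 0 i t)).sub
      (hUi t _ measurable_const fun _ => hq))
      ((integrable_finsetSum _ fun j _ => hi4 j).const_mul (1 / (n 0 : ℝ))) fun ω =>
      gameCost_sub_le hA1 (z := fun j => averages W x 0 j t ω)
        (fun j k => hgame.subset k (havX 0 j t ω k)) (g := fun j => g 0 j t ω)
        (fun j => hg 0 j t ω) i (hgame.subset 0 (hrun.state_mem 0 i t ω))
        (hgame.subset 0 hq)).trans ?_
    rw [integral_const_mul, integral_finsetSum _ fun j _ => hi4 j]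
    have hterm : ∀ j, ∫ ω, (g 0 j t ω (averages W x 0 j t ω 0 - q) +
        L * (‖x 0 i t ω - averages W x 0 j t ω 0‖ +
        2 * ‖averages W x 0 i t ω 1 - averages W x 0 j t ω 1‖)) ∂P ≤
        ∫ ω, ghat 0 j t ω (averages W x 0 j t ω 0 - q) ∂P + L * (2 * H 0 t + 4 * H 1 t) := by
      intro j
      rw [integral_add (hgai j t) (hi3 j), integral_const_mul, integral_add (hi1 j) (hi2 j),
        integral_const_mul, integral_apply_eq_of_condExp (hhist t) (hA2.integrable 0 j t)
          (hA2.unbiased 0 j t) (hwm j t).stronglyMeasurable (hwC j t)]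
      have h1 := integral_norm_sub_le_add (hxi 0 i t) (havi 0 j t 0) (hci 0 t)
      have h2 := integral_norm_sub_le_add (havi 0 i t 1) (havi 0 j t 1) (hci 1 t)
      have h3 := hdis 0 i t ht1
      have h4 := havg 0 j t 0 ht1
      have h5 := havg 0 j t 1 ht1
      have h6 := havg 0 i t 1 ht1
      refine add_le_add le_rfl (mul_le_mul_of_nonneg_left ?_ hL.le)
      linarith
    refine (mul_le_mul_of_nonneg_left (Finset.sum_le_sum fun j _ => hterm j)
      (by positivity)).trans_eq ?_
    rw [Finset.sum_add_distrib, mul_add, Finset.sum_const, Finset.card_univ, Fintype.card_fin,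
      nsmul_eq_mul, ← mul_assoc (1 / (n 0 : ℝ)), one_div_mul_cancel (hn' 0).ne', one_mul]
  have hmirror : ∑ t ∈ Finset.Icc 1 T, 1 / (n 0 : ℝ) *
      ∑ j, ∫ ω, ghat 0 j t ω (averages W x 0 j t ω 0 - q) ∂P ≤
      R₁ ^ 2 / α T + ∑ t ∈ Finset.Icc 1 T, α t / 2 * (L + ν 0) ^ 2 := by
    have hsqi : ∀ t j, Integrable (fun ω => α t / 2 * ‖ghat 0 j t ω‖ ^ 2) P := fun t j =>
      (hmom 0 j t).2.1.const_mul _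
    have hsum : ∑ t ∈ Finset.Icc 1 T, ∑ j,
        ∫ ω, ghat 0 j t ω (averages W x 0 j t ω 0 - q) ∂P ≤
        n 0 * R₁ ^ 2 / α T + ∑ t ∈ Finset.Icc 1 T, ∑ j, α t / 2 * ∫ ω, ‖ghat 0 j t ω‖ ^ 2 ∂P := by
      have e1 : ∑ t ∈ Finset.Icc 1 T, ∑ j,
          ∫ ω, ghat 0 j t ω (averages W x 0 j t ω 0 - q) ∂P =
          ∫ ω, ∑ t ∈ Finset.Icc 1 T, ∑ j, ghat 0 j t ω (averages W x 0 j t ω 0 - q) ∂P := by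
        rw [integral_finsetSum _ fun t _ => integrable_finsetSum _ fun j _ => hghati j t]
        exact Finset.sum_congr rfl fun t _ => (integral_finsetSum _ fun j _ => hghati j t).symm
      have hint : Integrable
          (fun ω => ∑ t ∈ Finset.Icc 1 T, ∑ j, α t / 2 * ‖ghat 0 j t ω‖ ^ 2) P :=
        integrable_finsetSum _ fun t _ => integrable_finsetSum _ fun j _ => hsqi t j
      have e2 : n 0 * R₁ ^ 2 / α T +
          ∑ t ∈ Finset.Icc 1 T, ∑ j, α t / 2 * ∫ ω, ‖ghat 0 j t ω‖ ^ 2 ∂P =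
          ∫ ω, (n 0 * R₁ ^ 2 / α T +
            ∑ t ∈ Finset.Icc 1 T, ∑ j, α t / 2 * ‖ghat 0 j t ω‖ ^ 2) ∂P := by
        rw [integral_add (integrable_const _) hint, integral_const, probReal_univ, one_smul,
          integral_finsetSum _ fun t _ => integrable_finsetSum _ fun j _ => hsqi t j]
        congr 1
        refine Finset.sum_congr rfl fun t _ => ?_
        rw [integral_finsetSum _ fun j _ => hsqi t j]
        simp only [integral_const_mul]
      rw [e1, e2]
      refine integral_mono
        (integrable_finsetSum _ fun t _ => integrable_finsetSum _ fun j _ => hghati j t)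
        ((integrable_const _).add hint) fun ω => ?_
      exact sum_linearized_regret_le (hX 0) (hψ 0) (hA3 0).convexOn (W := W 0 0)
        (fun t i => (hWs 0 0 t i).1) (hW 0).row_sum (hW 0).col_sum hα
        (x := fun t j => x 0 j t ω) (v := fun t j => averages W x 0 j t ω 0)
        (fun t j => hrun.state_mem 0 j t ω) (fun t j => rfl) (g := fun t j => ghat 0 j t ω)
        (fun t j => hrun.update 0 j t ω) (fun y hy y' hy' => hR₁.2 ⟨y, hy, y', hy', rfl⟩) hq T hT
    have hsq : ∀ t ∈ Finset.Icc 1 T, ∑ j, α t / 2 * ∫ ω, ‖ghat 0 j t ω‖ ^ 2 ∂P ≤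
        n 0 * (α t / 2 * (L + ν 0) ^ 2) := by
      intro t _
      have := hα0 t
      calc ∑ j, α t / 2 * ∫ ω, ‖ghat 0 j t ω‖ ^ 2 ∂P
          ≤ ∑ _j : Fin (n 0), α t / 2 * (L + ν 0) ^ 2 :=
            Finset.sum_le_sum fun j _ =>
              mul_le_mul_of_nonneg_left (hmom 0 j t).2.2 (by positivity)
        _ = _ := by simp
    have htot := hsum.trans (add_le_add le_rfl (Finset.sum_le_sum hsq))
    rw [← Finset.mul_sum] at htot ⊢
    rw [one_div_mul_eq_div, div_le_iff₀ (hn' 0)]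
    refine htot.trans_eq ?_
    ring
  refine (Finset.sum_le_sum hstep).trans ?_
  rw [Finset.sum_add_distrib]
  -- The last term of `disagreementBound` contributes `8 L (L + ν l) α (t - 1)`; adding `(L + ν l) ^
  -- 2 α (t - 1)` gives the coefficient `(L + ν l) (9 L + ν l)`. Monotonicity replaces `α t` by `α
  -- (t - 1)`, and the excess on the right is nonnegative.
  have hfinal : ∀ t ∈ Finset.Icc 1 T,
      L * (2 * H 0 t + 4 * H 1 t) + α t / 2 * (L + ν 0) ^ 2 ≤
      ∑ l, (L + ν l) * (9 * L + ν l) * α (t - 1) +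
      4 * L * (∑ l, n l * Γ l * (L + ν l) *
          ∑ s ∈ Finset.Icc 1 (t - 1), θ l ^ (t - 1 - s) * α (s - 1)) +
      4 * L * ∑ l, n l * Γ l * θ l ^ (t - 1) * Λ l := by
    intro t _
    have e : ∑ l, (L + ν l) * (9 * L + ν l) * α (t - 1) +
        4 * L * (∑ l, n l * Γ l * (L + ν l) *
          ∑ s ∈ Finset.Icc 1 (t - 1), θ l ^ (t - 1 - s) * α (s - 1)) +
        4 * L * ∑ l, n l * Γ l * θ l ^ (t - 1) * Λ l =
        4 * L * (H 0 t + H 1 t) + (L + ν 0) ^ 2 * α (t - 1) + (L + ν 1) ^ 2 * α (t - 1) := by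
      simp only [hH, disagreementBound, Fin.sum_univ_two]
      ring
    rw [e]
    have h1 := mul_nonneg hL.le (hH0 0 t)
    have h2 : (L + ν 0) ^ 2 * α t ≤ (L + ν 0) ^ 2 * α (t - 1) :=
      mul_le_mul_of_nonneg_left (hα (Nat.sub_le t 1)) (sq_nonneg _)
    have h3 := mul_nonneg (sq_nonneg (L + ν 1)) (hα0 (t - 1))
    have h4 := mul_nonneg (sq_nonneg (L + ν 0)) (hα0 t)
    linarith
  have hfin := Finset.sum_le_sum hfinal
  rw [Finset.sum_add_distrib, Finset.sum_add_distrib, Finset.sum_add_distrib] at hfin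
  rw [Finset.mul_sum, Finset.mul_sum]
  linarith
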